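/- Let $A$ be a countable alphabet with $d=|A|\in\{2,3,\dots,\infty\}$, let $\star\notin A$ be an additional symbol and let $\sigma$ be the left shift. An abstract kneading sequence is either a non-periodic sequence $\nu\in A^{\mathbb N}$, or a periodic sequence over $A\cup\{\star\}$ in which $\star$ occurs exactly once in the period, at the last position. For two sequences $a,b$ over $A\cup\{\star\}$, let $\operatorname{diff}(a,b)\in\{1,2,\dots\}\cup\{\infty\}$ be the first position at which $a$ and $b$ have different entries, where $\star$ counts as a wild card that does not differ from any symbol. The kneading sequence $\nu$ is recurrent if for every $k$ there is $n\ge 1$ with $\operatorname{diff}(\nu,\sigma^n\nu)\ge k$. Every periodic kneading sequence is recurrent. Let $\nu$ be a non-periodic kneading sequence. The space $X_\nu$ consists of the points $\sigma^k\nu$ ($k\ge0$), the precritical points $w\star\nu$ ($w$ a finite, possibly empty, word over $A$; depth $|w|+1$), and all sequences over $A$ except those of the form $w\nu$ with $w$ a non-empty word. Its topology has as basis the sets $U_k(a)=N_k(a)\setminus\partial_k(a)$ with $a\in X_\nu$, $k\ge1$, where $N_k(a)=\{b\in X_\nu:\operatorname{diff}(a,b)\ge k\}$ and $\partial_k(a)$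 is the set of precritical points of depth at most $k-1$ in $N_k(a)\setminus\{a\}$. Put $P_1=\{\star\nu\prec\nu\}$, and let $P_{n+1}$ arise from the totally ordered set $P_n$ by inserting, between any two adjacent elements $a\prec b$ with $k=\operatorname{diff}(a,b)<\infty$, the precritical point $w\star\nu$ of depth $k$ for which $w$ does not differ from the first $k-1$ entries of $a$ and of $b$. Let $P_\infty=\bigcup_n P_n$. The critical path $C_\nu\subset X_\nu$ consists of $P_\infty$ and of all sequences $x\in X_\nu$ over $A$ that are limits of points of $P_\infty$ (that is, for every $k$ there is $a\in P_\infty$ with $\operatorname{diff}(a,x)\ge k$). The Hubbard tree is $\mathcal H(\nu)=\bigcup_{n\ge0}\sigma^n(C_\nu)$ with the subspace topology of $X_\nu$. A branch point is a point $\tau\in\mathcal H(\nu)$ such that $\mathcal H(\nu)\setminus\{\tau\}$ has at least three connected components. **Lemma.** If a kneading sequence $\nu$ is non-recurrent (hence non-periodic), then $\mathcal H(\nu)$ has only finitely many branch points that are periodic under $\sigma$. This holds for all $d\in\{2,3,\dots,\infty\}$. -/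

import Mathlib

namespace Kneading

/-- Infinite sequences over `A ∪ {⋆}`; the symbol `⋆` is `none`, and positions are counted
from `0`. The degree `d` is the number of elements of the alphabet `A`. -/
abbrev Itinerary (A : Type*) := ℕ → Option A

variable {A : Type*}

/-- The `k`-th iterate of the left shift. -/
def shiftBy (k : ℕ) (x : Itinerary A) : Itinerary A := fun i => x (i + k)

/-- Abstract kneading sequences: either non-periodic sequences over `A`, or `⋆`-periodic
sequences, in which `⋆` occurs exactly at the last position of the period. -/
def IsKneadingSequence (ν : Itinerary A) : Prop :=
  ((∀ i, ν i ≠ none) ∧ ∀ p, 1 ≤ p → ¬ Function.Periodic ν p) ∨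
    ∃ p, 1 ≤ p ∧ Function.Periodic ν p ∧ ∀ i, ν i = none ↔ p ∣ i + 1

/-- The position (counted from `1`) of the first difference of two sequences, where `⋆` is a
wild card that does not differ from any symbol; `⊤` if there is no difference. -/
noncomputable def diff (a b : Itinerary A) : ℕ∞ :=
  ⨅ i ∈ {i : ℕ | a i ≠ none ∧ b i ≠ none ∧ a i ≠ b i}, ((i + 1 : ℕ) : ℕ∞)

/-- `ν` is recurrent: it is a limit of iterates `σⁿ ν`, `n ≥ 1`. -/
def IsRecurrent (ν : Itinerary A) : Prop :=
  ∀ k : ℕ, ∃ n, 1 ≤ n ∧ (k : ℕ∞) ≤ diff ν (shiftBy n ν)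

/-- `x = w⋆ν` for a word `w` of length `n` over `A`; the depth of this point is `n + 1`. -/
def IsPrecritical (ν : Itinerary A) (n : ℕ) (x : Itinerary A) : Prop :=
  (∀ i < n, x i ≠ none) ∧ x n = none ∧ shiftBy (n + 1) x = ν

/-- The points of the space `X_ν`: the orbit of the critical value `ν`, the precritical points
`w⋆ν`, and all sequences over `A` that are not of the form `wν` with `w` a non-empty word. -/
def IsPoint (ν x : Itinerary A) : Prop :=
  (∃ k, x = shiftBy k ν) ∨ (∃ n, IsPrecritical ν n x) ∨
    ((∀ i, x i ≠ none) ∧ ∀ n, 1 ≤ n → shiftBy n x ≠ ν)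

theorem IsPoint.shift {ν x : Itinerary A} (hx : IsPoint ν x) : IsPoint ν (shiftBy 1 x) := by
  have hadd : ∀ (m n : ℕ) (y : Itinerary A), shiftBy m (shiftBy n y) = shiftBy (m + n) y := by
    intro m n y
    funext i
    simp [shiftBy, Nat.add_assoc]
  rcases hx with ⟨k, rfl⟩ | ⟨n, h1, h2, h3⟩ | ⟨h1, h2⟩
  · exact Or.inl ⟨1 + k, hadd 1 k ν⟩
  · cases n with
    | zero =>
      refine Or.inl ⟨0, ?_⟩
      rw [← h3, hadd]
    | succ n =>
      refine Or.inr (Or.inl ⟨n, fun i hi => h1 (i + 1) (by omega), h2, ?_⟩)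
      rw [hadd]
      exact h3
  · refine Or.inr (Or.inr ⟨fun i => h1 (i + 1), fun n hn h => h2 (n + 1) (by omega) ?_⟩)
    rw [← h, hadd]

/-- The space `X_ν`. -/
def X (ν : Itinerary A) : Type _ := {x : Itinerary A // IsPoint ν x}

/-- The sequence of symbols of a point of `X_ν`. -/
def X.seq {ν : Itinerary A} (x : X ν) : Itinerary A := x.1

/-- The dynamics `σ : X_ν → X_ν`. -/
def X.shift {ν : Itinerary A} (x : X ν) : X ν := ⟨shiftBy 1 x.1, x.2.shift⟩

/-- `N_k(a)`. -/
def cylinder {ν : Itinerary A} (k : ℕ) (a : X ν) : Set (X ν) :=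
  {b | (k : ℕ∞) ≤ diff a.seq b.seq}

/-- `∂_k(a)`: the precritical points in `N_k(a) \ {a}` of depth at most `k - 1`, except `ν`. -/
def cylinderBoundary {ν : Itinerary A} (k : ℕ) (a : X ν) : Set (X ν) :=
  {b | b ∈ cylinder k a ∧ b ≠ a ∧ b.seq ≠ ν ∧ ∃ n, n + 1 < k ∧ IsPrecritical ν n b.seq}

/-- The topology of `X_ν` for non-periodic `ν`, with the sets `N_k(a) \ ∂_k(a)` as basis. -/
instance {ν : Itinerary A} : TopologicalSpace (X ν) :=
  TopologicalSpace.generateFrom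
    {U | ∃ (a : X ν) (k : ℕ), 1 ≤ k ∧ U = cylinder k a \ cylinderBoundary k a}

/-- The critical point `⋆ν`. -/
def criticalPoint (ν : Itinerary A) : Itinerary A
  | 0 => none
  | i + 1 => ν i

/-- The point `w''⋆ν` where the word `w''` has length `m` and does not differ from `a` and `b`. -/
def insertedPoint (ν a b : Itinerary A) (m : ℕ) : Itinerary A := fun i =>
  if i < m then (a i).or (b i) else if i = m then none else ν (i - (m + 1))

open Classical in
/-- What is inserted between adjacent points `a ≺ b`: nothing if `diff a b = ∞`, and otherwise
one precritical point of depth `diff a b`. -/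
noncomputable def inserted (ν a b : Itinerary A) : List (Itinerary A) :=
  if diff a b = ⊤ then [] else [insertedPoint ν a b ((diff a b).toNat - 1)]

/-- Insertion between all pairs of adjacent elements of a list. -/
noncomputable def insertAll (ν : Itinerary A) : List (Itinerary A) → List (Itinerary A)
  | a :: b :: l => a :: (inserted ν a b ++ insertAll ν (b :: l))
  | l => l

/-- The totally ordered set `P_{n+1}`, listed in increasing order from `⋆ν` to `ν`. -/
noncomputable def precriticalList (ν : Itinerary A) : ℕ → List (Itinerary A)
  | 0 => [criticalPoint ν, ν]
  | n + 1 => insertAll ν (precriticalList ν n)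

/-- `P_∞`, the set of precritical points on the critical path. -/
def pathPrecritical (ν : Itinerary A) : Set (X ν) :=
  {x | ∃ n, x.seq ∈ precriticalList ν n}

/-- `L_ν`, the limit points of `P_∞` in `X_ν` that are sequences over `A`. -/
def pathLimits (ν : Itinerary A) : Set (X ν) :=
  {x | (∀ i, x.seq i ≠ none) ∧ ∀ k : ℕ, ∃ a ∈ pathPrecritical ν, (k : ℕ∞) ≤ diff a.seq x.seq}

/-- The critical path `C_ν`, from `⋆ν` to `ν`, of a non-periodic kneading sequence. -/
def criticalPath (ν : Itinerary A) : Set (X ν) := pathPrecritical ν ∪ pathLimits ν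

/-- The Hubbard tree of a non-periodic kneading sequence, as a subspace of `X_ν`.
(For `⋆`-periodic `ν`, Fatou intervals would have to be added. Such `ν` are recurrent, see
`not_isRecurrent_imp` below.) -/
def hubbardTree (ν : Itinerary A) : Set (X ν) :=
  ⋃ n : ℕ, (X.shift^[n]) '' criticalPath ν

/-- The branches (global arms) of the Hubbard tree at `τ`: the connected components of the tree
without the point `τ`. -/
def Branches {ν : Itinerary A} (τ : X ν) : Type _ :=
  ConnectedComponents ↥(hubbardTree ν \ {τ})

/-- A branch point is a point of the Hubbard tree with at least three branches. -/
def IsBranchPoint {ν : Itinerary A} (τ : X ν) : Prop :=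
  τ ∈ hubbardTree ν ∧ 3 ≤ ENat.card (Branches τ)

/-- A non-recurrent kneading sequence is of the first kind: non-periodic, without `⋆`. -/
theorem not_isRecurrent_imp {ν : Itinerary A} (hν : IsKneadingSequence ν)
    (h : ¬ IsRecurrent ν) : (∀ i, ν i ≠ none) ∧ ∀ p, 1 ≤ p → ¬ Function.Periodic ν p := by
  rcases hν with h1 | ⟨p, hp, hper, -⟩
  · exact h1
  · refine absurd (fun k => ⟨p, hp, ?_⟩) h
    have : shiftBy p ν = ν := funext hper
    simp [this, diff]

end Kneading

namespace Kneading

variable {A : Type*} {ν : Itinerary A}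

/-! Betweenness is made combinatorial. To locate x relative to z, both are shifted together, and
whenever the critical point separates them (a `Hit`), the image of x is replaced by ν. Two points
lie in one branch at z if they share a suitable hit (`SameSide`); otherwise z lies between them.

Finiteness: non-recurrence gives N such that ν agrees with no σⁿν, n ≥ 1, on the first N entries. A
periodic τ contains no ⋆, so points in different branches at τ never hit simultaneously, while each
hits infinitely often. After a suitable hit, three such points have become ν, σᵏν and σˡν with k, l
≤ N (`isMiddle_of_hits`, `exists_isMiddle`). Hence an iterate of τ is the middle of this triod, and
the triod determines its middle by majority vote (`eq_of_three_branches`). Each of the finitely many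
pairs (k, l) accounts for at most one periodic orbit, whatever the size of the alphabet.

Topology: three components yield three combinatorial branches once every combinatorial branch is
known to be connected (`isPreconnected_branch`). This is a bisection with inserted precritical
points, and it needs the tree to be convex (`exists_represents`). A limit of the bisection may have
the forbidden form weν; the point w⋆ν then stands in for it. That this point is still on the
critical path holds because ν is an endpoint (`sameSide_critical_value`), which again follows from
non-recurrence. -/

/-! ### Shifts and agreement up to wild cards -/

theorem shiftBy_zero (x : Itinerary A) : shiftBy 0 x = x := rfl

theorem shiftBy_shiftBy (m n : ℕ) (x : Itinerary A) :
    shiftBy m (shiftBy n x) = shiftBy (m + n) x := by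
  funext i
  simp [shiftBy, Nat.add_assoc]

/-- `a` and `b` do not differ at the first `n` positions. -/
def Agree (a b : Itinerary A) (n : ℕ) : Prop :=
  ∀ i < n, a i = none ∨ b i = none ∨ a i = b i

theorem Agree.mono {a b : Itinerary A} {m n : ℕ} (h : Agree a b n) (hmn : m ≤ n) :
    Agree a b m := fun i hi => h i (by omega)

theorem Agree.symm {a b : Itinerary A} {n : ℕ} (h : Agree a b n) : Agree b a n := fun i hi => by
  rcases h i hi with h | h | h
  · exact Or.inr (Or.inl h)
  · exact Or.inl h
  · exact Or.inr (Or.inr h.symm)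

theorem le_diff_iff {a b : Itinerary A} {k : ℕ} : (k : ℕ∞) ≤ diff a b ↔ Agree a b (k - 1) := by
  unfold diff Agree
  simp only [le_iInf_iff, Nat.cast_le, Set.mem_ofPred_eq]
  constructor
  · intro h i hi
    by_contra! hc
    have := h i hc
    omega
  · rintro h i ⟨h1, h2, h3⟩
    by_contra hk
    rcases h i (by omega) with h | h | h <;> contradiction

theorem exists_first_diff {a b : Itinerary A} (h : ∃ i, ¬ (a i = none ∨ b i = none ∨ a i = b i)) :
    ∃ m : ℕ, diff a b = ((m + 1 : ℕ) : ℕ∞) ∧ Agree a b m ∧ a m ≠ none ∧ b m ≠ none ∧ a m ≠ b m := by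
  classical
  have hs := Nat.find_spec h
  have hm := fun i hi => not_not.1 (Nat.find_min h (m := i) hi)
  set m := Nat.find h
  push Not at hs
  refine ⟨m, le_antisymm ?_ ?_, hm, hs⟩
  · exact iInf₂_le (f := fun (i : ℕ) _ => ((i + 1 : ℕ) : ℕ∞)) m hs
  · exact le_diff_iff.2 hm

/-- The tail of a sequence after a symbol `⋆` is `ν`. -/
def Good (ν z : Itinerary A) : Prop := ∀ n, z n = none → shiftBy (n + 1) z = ν

theorem good_of_ne_none {z : Itinerary A} (h : ∀ i, z i ≠ none) : Good ν z :=
  fun n hn => absurd hn (h n)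

theorem Good.shifted {z : Itinerary A} (h : Good ν z) (n : ℕ) : Good ν (shiftBy n z) := by
  intro m hm
  rw [shiftBy_shiftBy, ← h (m + n) hm]
  congr 1
  omega

/-! ### Combinatorial branches and betweenness -/

open Classical in
/-- The sequence `x` followed along `z`: it is shifted as long as its first symbol is the current
symbol of `z`, and replaced by `ν` otherwise. -/
noncomputable def track (ν z x : Itinerary A) : ℕ → Itinerary A
  | 0 => x
  | n + 1 => if track ν z x n 0 = z n then shiftBy 1 (track ν z x n) else ν

/-- At time `n`, the critical point separates `z` from `x` (followed along `z`). -/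
def Hit (ν z x : Itinerary A) (n : ℕ) : Prop := track ν z x n 0 ≠ z n

/-- `x` and `y` lie in the same branch at `z`. -/
def SameSide (ν z x y : Itinerary A) : Prop :=
  ∃ n, Hit ν z x n ∧ Hit ν z y n ∧ (z n = none → track ν z x n 0 = track ν z y n 0)

theorem SameSide.symm {z x y : Itinerary A} (h : SameSide ν z x y) : SameSide ν z y x := by
  obtain ⟨n, h1, h2, h3⟩ := h
  exact ⟨n, h2, h1, fun h => (h3 h).symm⟩

theorem track_succ_of_hit {z x : Itinerary A} {n : ℕ} (h : Hit ν z x n) :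
    track ν z x (n + 1) = ν := if_neg h

theorem track_succ_of_not_hit {z x : Itinerary A} {n : ℕ} (h : ¬ Hit ν z x n) :
    track ν z x (n + 1) = shiftBy 1 (track ν z x n) := if_pos (not_not.1 h)

theorem track_add (z x : Itinerary A) (n m : ℕ) :
    track ν z x (n + m) = track ν (shiftBy n z) (track ν z x n) m := by
  induction m with
  | zero => rfl
  | succ m ih =>
    rw [← Nat.add_assoc]
    have he : shiftBy n z m = z (n + m) := by rw [shiftBy, Nat.add_comm]
    by_cases h : track ν (shiftBy n z) (track ν z x n) m 0 = z (n + m)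
    · rw [track, track, he, ih, if_pos h]
    · rw [track, track, he, ih, if_neg h]

theorem hit_add {z x : Itinerary A} {n m : ℕ} :
    Hit ν z x (n + m) ↔ Hit ν (shiftBy n z) (track ν z x n) m := by
  simp only [Hit, track_add, shiftBy, Nat.add_comm m n]

theorem SameSide.of_shiftBy {z x y : Itinerary A} {n : ℕ}
    (h : SameSide ν (shiftBy n z) (track ν z x n) (track ν z y n)) : SameSide ν z x y := by
  obtain ⟨m, h1, h2, h3⟩ := h
  refine ⟨n + m, hit_add.2 h1, hit_add.2 h2, fun h => ?_⟩
  rw [track_add, track_add]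
  exact h3 (by rw [← h, shiftBy, Nat.add_comm])

theorem track_of_not_hit {z x : Itinerary A} {m n : ℕ}
    (h : ∀ i < n, ¬ Hit ν z x (m + i)) : track ν z x (m + n) = shiftBy n (track ν z x m) := by
  induction n with
  | zero => rfl
  | succ n ih =>
    rw [← Nat.add_assoc, track_succ_of_not_hit (h n (by omega)), ih fun i hi => h i (by omega),
      shiftBy_shiftBy, Nat.add_comm]

theorem eq_of_not_hit {z x : Itinerary A} {m n : ℕ}
    (h : ∀ i ≤ n, ¬ Hit ν z x (m + i)) : track ν z x m n = z (m + n) := by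
  have h1 := not_not.1 (h n le_rfl)
  rw [track_of_not_hit fun i hi => h i (by omega)] at h1
  simpa [shiftBy] using h1

theorem track_eq_shiftBy_of_eq {z x : Itinerary A} {n : ℕ} (h : ∀ i < n, x i = z i) :
    track ν z x n = shiftBy n x := by
  induction n with
  | zero => rfl
  | succ n ih =>
    have ih := ih fun i hi => h i (by omega)
    have h1 : ¬ Hit ν z x n := by
      rw [Hit, not_not, ih, ← h n (by omega)]
      simp [shiftBy]
    rw [track_succ_of_not_hit h1, ih, shiftBy_shiftBy, Nat.add_comm]

theorem not_hit_self (x : Itinerary A) (n : ℕ) : ¬ Hit ν x x n := by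
  rw [Hit, not_not, track_eq_shiftBy_of_eq fun _ _ => rfl]
  simp [shiftBy]

theorem not_sameSide_left (x y : Itinerary A) : ¬ SameSide ν x x y :=
  fun ⟨n, h, _⟩ => not_hit_self x n h

theorem not_sameSide_right (x y : Itinerary A) : ¬ SameSide ν y x y :=
  fun ⟨n, _, h, _⟩ => not_hit_self y n h

theorem exists_hit {z x : Itinerary A} (m : ℕ) (h : track ν z x m ≠ shiftBy m z) :
    ∃ n, m ≤ n ∧ Hit ν z x n := by
  by_contra! hc
  refine h (funext fun i => ?_)
  rw [eq_of_not_hit fun i _ => hc (m + i) (by omega), shiftBy, Nat.add_comm]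

theorem SameSide.refl {z x : Itinerary A} (h : x ≠ z) : SameSide ν z x x := by
  obtain ⟨n, -, hn⟩ := exists_hit (ν := ν) (z := z) (x := x) 0 h
  exact ⟨n, hn, hn, fun _ => rfl⟩

theorem track_congr {z z' x : Itinerary A} {n : ℕ} (h : ∀ i < n, z i = z' i) :
    track ν z x n = track ν z' x n := by
  induction n with
  | zero => rfl
  | succ n ih =>
    by_cases hc : track ν z' x n 0 = z' n
    · rw [track, track, ih fun i hi => h i (by omega), h n (by omega), if_pos hc]
    · rw [track, track, ih fun i hi => h i (by omega), h n (by omega), if_neg hc]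

theorem track_eq_of_le {z x y : Itinerary A} {m n : ℕ} (h : track ν z x m = track ν z y m)
    (hmn : m ≤ n) : track ν z x n = track ν z y n := by
  obtain ⟨k, rfl⟩ := Nat.exists_eq_add_of_le hmn
  rw [track_add, track_add, h]

theorem Good.tracked (hν : ∀ i, ν i ≠ none) {x : Itinerary A} (hx : Good ν x) (z : Itinerary A)
    (n : ℕ) : Good ν (track ν z x n) := by
  induction n with
  | zero => exact hx
  | succ n ih =>
    by_cases h : Hit ν z x n
    · rw [track_succ_of_hit h]
      exact good_of_ne_none hν
    · rw [track_succ_of_not_hit h]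
      exact ih.shifted 1

theorem track_succ_of_none (hν : ∀ i, ν i ≠ none) {z x : Itinerary A} (hx : Good ν x) {n : ℕ}
    (hn : z n = none) : track ν z x (n + 1) = ν := by
  by_cases h : Hit ν z x n
  · exact track_succ_of_hit h
  · rw [track_succ_of_not_hit h]
    exact hx.tracked hν z n 0 ((not_not.1 h).trans hn)

/-- After a ⋆ in `z` both sequences continue as ν, so nothing can separate them any more. -/
theorem not_hit_of_none (hν : ∀ i, ν i ≠ none) {z x : Itinerary A} (hz : Good ν z)
    (hx : Good ν x) {m n : ℕ} (hm : z m = none) (hmn : m < n) : ¬ Hit ν z x n := by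
  obtain ⟨k, rfl⟩ := Nat.exists_eq_add_of_le (Nat.succ_le_of_lt hmn)
  rw [Nat.succ_eq_add_one, hit_add, track_succ_of_none hν hx hm, hz m hm]
  exact not_hit_self ν k

/-- A common hit resets both sequences to ν, so from then on they are followed identically; the
later of the two hits is therefore shared by all three. -/
theorem SameSide.trans {z x y w : Itinerary A} (h1 : SameSide ν z x y)
    (h2 : SameSide ν z y w) : SameSide ν z x w := by
  obtain ⟨n, hxn, hyn, hn⟩ := h1
  obtain ⟨m, hym, hwm, hm⟩ := h2
  rcases lt_trichotomy n m with h | rfl | h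
  · have he : track ν z x m = track ν z y m :=
      track_eq_of_le (by rw [track_succ_of_hit hxn, track_succ_of_hit hyn]) (Nat.succ_le_of_lt h)
    exact ⟨m, by rwa [Hit, he], hwm, fun h => by rw [he, hm h]⟩
  · exact ⟨n, hxn, hwm, fun h => (hn h).trans (hm h)⟩
  · have he : track ν z y n = track ν z w n :=
      track_eq_of_le (by rw [track_succ_of_hit hym, track_succ_of_hit hwm]) (Nat.succ_le_of_lt h)
    exact ⟨n, hxn, by rwa [Hit, ← he], fun h => by rw [← he, hn h]⟩

open Classical in
/-- If `z` separates `x` from `r` and `s`, then `r` and `s` lie in the same branch at `x`. -/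
theorem SameSide.change_center (hν : ∀ i, ν i ≠ none) {z r s x : Itinerary A} (hz : Good ν z)
    (hr : Good ν r) (h : SameSide ν z r s)
    (hn : ¬ SameSide ν z r x) : SameSide ν x r s := by
  have hns : ¬ SameSide ν z s x := fun h' => hn (h.trans h')
  obtain ⟨n, hrn, hsn, he⟩ := h
  -- If `x` leaves `z` before the common hit, then at that moment `r` and `s` still follow `z`, so
  -- `x` sees both leave at once. Otherwise the hit time `n` itself serves.
  by_cases hc : ∃ t, t < n ∧ x t ≠ z t
  · have hts := Nat.find_spec hc
    have htm : ∀ i < Nat.find hc, x i = z i := fun i hi => by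
      have := Nat.find_min hc hi
      by_contra h
      exact this ⟨by omega, h⟩
    set t := Nat.find hc
    obtain ⟨htn, hxt⟩ := hts
    have hzt : z t ≠ none := fun h => not_hit_of_none hν hz hr h htn hrn
    have hhx : Hit ν z x t := by
      rw [Hit, track_eq_shiftBy_of_eq htm]
      simpa [shiftBy] using hxt
    have h1 : track ν z r t 0 = z t := by
      by_contra h
      exact hn ⟨t, h, hhx, fun h => absurd h hzt⟩
    have h2 : track ν z s t 0 = z t := by
      by_contra h
      exact hns ⟨t, h, hhx, fun h => absurd h hzt⟩
    rw [← track_congr htm] at h1 h2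
    exact ⟨t, by rw [Hit, h1]; exact hxt.symm, by rw [Hit, h2]; exact hxt.symm,
      fun _ => by rw [h1, h2]⟩
  · have hc : ∀ i < n, x i = z i := by
      intro i hi
      by_contra h
      exact hc ⟨i, hi, h⟩
    have htx : track ν z x n 0 = x n := by
      rw [track_eq_shiftBy_of_eq hc]
      simp [shiftBy]
    by_cases hxz : x n = z n
    · refine ⟨n, ?_, ?_, ?_⟩
      · rw [Hit, track_congr hc, hxz]; exact hrn
      · rw [Hit, track_congr hc, hxz]; exact hsn
      · rw [track_congr hc, track_congr hc, hxz]; exact he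
    · have hzn : z n = none := by
        by_contra h
        exact hn ⟨n, hrn, by rwa [Hit, htx], fun h' => absurd h' h⟩
      have hxn : x n ≠ none := fun h => hxz (h.trans hzn.symm)
      have h1 : track ν z r n 0 ≠ x n := fun h =>
        hn ⟨n, hrn, by rwa [Hit, htx], fun _ => by rw [h, htx]⟩
      refine ⟨n, ?_, ?_, fun h => absurd h hxn⟩
      · rwa [Hit, track_congr hc]
      · rwa [Hit, track_congr hc, ← he hzn]

-- Antisymmetry of betweenness: if `x` is between `r` and `y`, then `y` is not between `r` and `x`.
-- The first difference of `x` and `y` decides: there, `r` either leaves `y` at once, or follows `y`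
-- and is separated from `x`.
open Classical in
theorem sameSide_of_not_sameSide {x y r : Itinerary A} (hxy : x ≠ y)
    (h : ¬ SameSide ν x r y) : SameSide ν y r x := by
  have hc : ∃ t, x t ≠ y t := Function.ne_iff.1 hxy
  have hts := Nat.find_spec hc
  have htm : ∀ i < Nat.find hc, y i = x i := fun i hi => (not_not.1 (Nat.find_min hc hi)).symm
  set t := Nat.find hc
  have hyt : track ν x y t 0 = y t := by
    rw [track_eq_shiftBy_of_eq htm]
    simp [shiftBy]
  have hxt : track ν y x t 0 = x t := by
    rw [track_eq_shiftBy_of_eq fun i hi => (htm i hi).symm]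
    simp [shiftBy]
  by_cases hr : Hit ν x r t
  · have hxn : x t = none ∧ track ν x r t 0 ≠ y t := by
      by_contra hcon
      refine h ⟨t, hr, by rw [Hit, hyt]; exact hts.symm, fun h' => ?_⟩
      rw [hyt]
      by_contra h2
      exact hcon ⟨h', h2⟩
    refine ⟨t, ?_, by rwa [Hit, hxt], fun h' => absurd (hxn.1.trans h'.symm) hts⟩
    rw [Hit, track_congr htm]
    exact hxn.2
  · have hr : track ν x r t 0 = x t := not_not.1 hr
    rw [← track_congr htm] at hr
    exact ⟨t, by rwa [Hit, hr], by rwa [Hit, hxt], fun _ => by rw [hr, hxt]⟩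

/-- A sequence over `A` is determined by three sequences in different branches. -/
theorem eq_of_three_branches {τ τ' x y z : Itinerary A} (hτ : ∀ i, τ i ≠ none)
    (hτ' : ∀ i, τ' i ≠ none)
    (h : ¬ SameSide ν τ x y ∧ ¬ SameSide ν τ x z ∧ ¬ SameSide ν τ y z)
    (h' : ¬ SameSide ν τ' x y ∧ ¬ SameSide ν τ' x z ∧ ¬ SameSide ν τ' y z) : τ = τ' := by
  funext n
  induction n using Nat.strong_induction_on with
  | _ n ih =>
    -- At most one of the three sequences leaves the middle at time `n`, so its symbol is the
    -- majority of three symbols, which by induction are the same for `τ` and `τ'`.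
    have aux : ∀ {τ x y : Itinerary A}, (∀ i, τ i ≠ none) → ¬ SameSide ν τ x y →
        track ν τ x n 0 = τ n ∨ track ν τ y n 0 = τ n := by
      intro τ x y hτ h
      by_contra! hc
      exact h ⟨n, hc.1, hc.2, fun h => absurd h (hτ n)⟩
    have a1 := aux hτ h.1
    have a2 := aux hτ h.2.1
    have a3 := aux hτ h.2.2
    have b1 := aux hτ' h'.1
    have b2 := aux hτ' h'.2.1
    have b3 := aux hτ' h'.2.2
    rw [← track_congr ih, ← track_congr ih] at b1 b2 b3
    rcases a1 with a | a <;> rcases b1 with b | b <;> rcases a2 with c | c <;>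
      rcases b2 with d | d <;> rcases a3 with e | e <;> rcases b3 with f | f <;> simp_all

/-! ### Points of the space -/

theorem isPoint_shiftBy {x : Itinerary A} (hx : IsPoint ν x) (n : ℕ) :
    IsPoint ν (shiftBy n x) := by
  induction n with
  | zero => exact hx
  | succ n ih =>
    rw [Nat.add_comm, ← shiftBy_shiftBy]
    exact ih.shift

theorem isPoint_self : IsPoint ν ν := Or.inl ⟨0, rfl⟩

theorem IsPrecritical.good (hν : ∀ i, ν i ≠ none) {n : ℕ} {x : Itinerary A}
    (h : IsPrecritical ν n x) : Good ν x := by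
  intro m hm
  obtain ⟨h1, h2, h3⟩ := h
  rcases lt_trichotomy m n with h | rfl | h
  · exact absurd hm (h1 m h)
  · exact h3
  · obtain ⟨k, rfl⟩ := Nat.exists_eq_add_of_lt h
    have := congrFun h3 k
    rw [shiftBy, ← Nat.add_assoc, show k + n + 1 = n + k + 1 by omega, hm] at this
    exact absurd this.symm (hν k)

theorem IsPoint.good (hν : ∀ i, ν i ≠ none) {x : Itinerary A} (h : IsPoint ν x) : Good ν x := by
  rcases h with ⟨k, rfl⟩ | ⟨n, h⟩ | ⟨h, -⟩
  · exact good_of_ne_none fun i => hν _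
  · exact h.good hν
  · exact good_of_ne_none h

theorem Good.isPrecritical (hν : ∀ i, ν i ≠ none) {x : Itinerary A} (h : Good ν x) {n : ℕ}
    (hn : x n = none) : IsPrecritical ν n x := by
  refine ⟨fun i hi hxi => ?_, hn, h n hn⟩
  have := congrFun (h i hxi) (n - (i + 1))
  rw [shiftBy, show n - (i + 1) + (i + 1) = n by omega, hn] at this
  exact hν _ this.symm

theorem Good.ext (hν : ∀ i, ν i ≠ none) {x y : Itinerary A} (hx : Good ν x) (hy : Good ν y)
    {n : ℕ} (h : Agree x y n) (hxn : x n = none) (hyn : y n = none) : x = y := by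
  have hx' := hx.isPrecritical hν hxn
  have hy' := hy.isPrecritical hν hyn
  funext i
  rcases lt_trichotomy i n with hi | rfl | hi
  · rcases h i hi with h | h | h
    · exact absurd h (hx'.1 i hi)
    · exact absurd h (hy'.1 i hi)
    · exact h
  · rw [hxn, hyn]
  · have := congrFun (hx'.2.2.trans hy'.2.2.symm) (i - (n + 1))
    rwa [shiftBy, shiftBy, show i - (n + 1) + (n + 1) = i by omega] at this

/-- This is where the exclusion of the words wν from the space enters; the remaining possibilities
would make ν periodic. -/
theorem IsPoint.isPrecritical (hν : ∀ i, ν i ≠ none) (hp : ∀ n, 1 ≤ n → shiftBy n ν ≠ ν)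
    {x : Itinerary A} (hx : IsPoint ν x) {n : ℕ} (h : shiftBy (n + 1) x = ν) :
    IsPrecritical ν n x := by
  rcases hx with ⟨k, rfl⟩ | ⟨m, h1, h2, h3⟩ | ⟨h1, h2⟩
  · rw [shiftBy_shiftBy] at h
    exact absurd h (hp _ (by omega))
  · rcases lt_trichotomy m n with hm | rfl | hm
    · refine absurd ?_ (hp (n - m) (by omega))
      rw [← h3, shiftBy_shiftBy, ← Nat.add_assoc, show n - m + m = n by omega, h, h3]
    · exact ⟨h1, h2, h3⟩
    · have := congrFun h (m - (n + 1))
      rw [shiftBy, show m - (n + 1) + (n + 1) = m by omega, h2] at this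
      exact absurd this.symm (hν _)
  · exact absurd h (h2 _ (by omega))

theorem IsPoint.ext_aux (hν : ∀ i, ν i ≠ none) (hp : ∀ n, 1 ≤ n → shiftBy n ν ≠ ν)
    {x y : Itinerary A} (hx : IsPoint ν x) (hy : IsPoint ν y) (h : ∀ k, Agree x y k)
    {n : ℕ} (hxn : x n = none) (hm : ∀ m ≤ n, y m = none → m = n) : x = y := by
  by_cases hyn : y n = none
  · exact (hx.good hν).ext hν (hy.good hν) (h n) hxn hyn
  have hs := hx.good hν n hxn
  by_cases hc : ∃ m, y m = none
  · obtain ⟨m, hm'⟩ := hc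
    have hnm : n < m := by
      by_contra hc
      have := hm m (by omega) hm'
      subst this
      exact hyn hm'
    -- A later ⋆ in `y` would give ν and its shift by `m - n` the same entries.
    refine absurd ?_ (hp (m - n) (by omega))
    funext i
    have h1 := congrFun (hy.good hν m hm') i
    have h2 := congrFun hs (i + (m - n))
    rw [shiftBy, show i + (m - n) + (n + 1) = i + (m + 1) by omega] at h2
    rw [shiftBy] at h1
    have h3 := h (i + (m + 1) + 1) (i + (m + 1)) (by omega)
    rw [h1, h2] at h3
    rcases h3 with h | h | h
    · exact absurd h (hν _)
    · exact absurd h (hν _)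
    · exact h
  · push Not at hc
    refine absurd (hy.isPrecritical hν hp (n := n) ?_).2.1 hyn
    funext i
    have h2 := congrFun hs i
    rw [shiftBy] at h2 ⊢
    have h3 := h (i + (n + 1) + 1) (i + (n + 1)) (by omega)
    rw [h2] at h3
    rcases h3 with h | h | h
    · exact absurd h (hν _)
    · exact absurd h (hc _)
    · exact h.symm

open Classical in
/-- Distinct points of `X_ν` differ at some position. -/
theorem IsPoint.ext (hν : ∀ i, ν i ≠ none) (hp : ∀ n, 1 ≤ n → shiftBy n ν ≠ ν)
    {x y : Itinerary A} (hx : IsPoint ν x) (hy : IsPoint ν y) (h : ∀ k, Agree x y k) : x = y := by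
  by_cases hc : ∃ n, x n = none ∨ y n = none
  · have hs := Nat.find_spec hc
    have hm := fun i hi => Nat.find_min hc (m := i) hi
    set n := Nat.find hc
    push Not at hm
    rcases hs with hs | hs
    · refine hx.ext_aux hν hp hy h hs fun m hmn hy => ?_
      by_contra hne
      exact (hm m (by omega)).2 hy
    · refine (hy.ext_aux hν hp hx (fun k => (h k).symm) hs fun m hmn hy => ?_).symm
      by_contra hne
      exact (hm m (by omega)).1 hy
  · push Not at hc
    funext i
    rcases h (i + 1) i (by omega) with h | h | h
    · exact absurd h (hc i).1
    · exact absurd h (hc i).2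
    · exact h

/-- A hit at a ⋆ of `x` is harmless: the reset to ν coincides with the shift, because ν is what
follows ⋆. -/
theorem track_eq_shiftBy {z x : Itinerary A} (hx : Good ν x) {n : ℕ}
    (h : ∀ i < n, x i = none ∨ x i = z i) : track ν z x n = shiftBy n x := by
  induction n with
  | zero => rfl
  | succ n ih =>
    have ih := ih fun i hi => h i (by omega)
    have h0 : track ν z x n 0 = x n := by rw [ih, shiftBy, Nat.zero_add]
    by_cases hh : Hit ν z x n
    · rw [track_succ_of_hit hh]
      rcases h n (by omega) with h | h
      · exact (hx n h).symm
      · exact absurd (h0.trans h) hh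
    · rw [track_succ_of_not_hit hh, ih, shiftBy_shiftBy, Nat.add_comm]

theorem exists_track_shiftBy (z : Itinerary A) (k n : ℕ) :
    ∃ i, track ν z (shiftBy k ν) n = shiftBy i ν := by
  induction n with
  | zero => exact ⟨k, rfl⟩
  | succ n ih =>
    by_cases h : Hit ν z (shiftBy k ν) n
    · exact ⟨0, track_succ_of_hit h⟩
    · obtain ⟨i, hi⟩ := ih
      exact ⟨1 + i, by rw [track_succ_of_not_hit h, hi, shiftBy_shiftBy]⟩

theorem isPrecritical_criticalPoint : IsPrecritical ν 0 (criticalPoint ν) :=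
  ⟨fun i hi => absurd hi (by omega), rfl, rfl⟩

theorem exists_track_criticalPoint (z : Itinerary A) (n : ℕ) :
    ∃ i, track ν z (criticalPoint ν) (n + 1) = shiftBy i ν := by
  have h1 : track ν z (criticalPoint ν) 1 = ν := by
    by_cases h : Hit ν z (criticalPoint ν) 0
    · exact track_succ_of_hit h
    · exact track_succ_of_not_hit h
  rw [Nat.add_comm, track_add, h1]
  exact exists_track_shiftBy _ 0 n

/-! ### The critical value is an endpoint -/

/-- The states of `σⁱν` followed along `ν` form a finite set, if `ν` is non-recurrent. -/
theorem track_self_bounded {N : ℕ} (hN : ∀ n, 1 ≤ n → ∃ i < N, ν i ≠ ν (i + n)) {i : ℕ}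
    (hi : 1 ≤ i) (k : ℕ) : ∃ m ≤ i + N, track ν ν (shiftBy i ν) k = shiftBy m ν ∧
      track ν ν (shiftBy i ν) k ≠ shiftBy k ν := by
  -- Here `s` is the time of the last reset (0 if none), `e` the index of the state at that time and
  -- `l` the number of steps since. These `l` steps are a self-agreement of ν, so non-recurrence
  -- bounds `l`.
  have inv : ∃ s e l, k = s + l ∧ track ν ν (shiftBy i ν) k = shiftBy (e + l) ν ∧
      (e = 0 ∧ 1 ≤ s ∨ e = i ∧ s = 0) ∧ ∀ j < l, ν (j + e) = ν (j + s) := by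
    induction k with
    | zero => exact ⟨0, i, 0, rfl, rfl, Or.inr ⟨rfl, rfl⟩, by simp⟩
    | succ k ih =>
      by_cases h : Hit ν ν (shiftBy i ν) k
      · exact ⟨k + 1, 0, 0, rfl, track_succ_of_hit h, Or.inl ⟨rfl, by omega⟩, by simp⟩
      · obtain ⟨s, e, l, hk, h1, h2, h3⟩ := ih
        refine ⟨s, e, l + 1, by omega, ?_, h2, fun j hj => ?_⟩
        · rw [track_succ_of_not_hit h, h1, shiftBy_shiftBy]
          congr 1
          omega
        · rcases Nat.lt_succ_iff_lt_or_eq.1 hj with hj | rfl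
          · exact h3 j hj
          · have := not_not.1 h
            rw [h1, shiftBy, hk] at this
            rw [Nat.add_comm j e, Nat.add_comm j s, ← this, Nat.zero_add]
  obtain ⟨s, e, l, hk, h1, h2, h3⟩ := inv
  have hlt : ∃ j < N, ν (j + e) ≠ ν (j + s) := by
    rcases h2 with ⟨rfl, hs⟩ | ⟨rfl, rfl⟩
    · exact hN s hs
    · obtain ⟨j, hj, h⟩ := hN e hi
      exact ⟨j, hj, h.symm⟩
  obtain ⟨j, hj, hne⟩ := hlt
  have hlj : l ≤ j := by
    by_contra h
    exact hne (h3 j (by omega))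
  refine ⟨e + l, by omega, h1, fun h => hne ?_⟩
  have := congrFun (h1.symm.trans h) (j - l)
  rw [shiftBy, shiftBy, hk] at this
  convert this using 2 <;> omega

/-- If ν separated the two iterates, then each σᵏν would separate their followed images at time k,
so at least one image lies beyond σᵏν as seen from ν. All images of points of a finite set `S` stay
in `S`, so the strict order "beyond" on `S` would have no extremal element. -/
theorem sameSide_critical_value (hν : ∀ i, ν i ≠ none) {N : ℕ}
    (hN : ∀ n, 1 ≤ n → ∃ i < N, ν i ≠ ν (i + n)) {i j : ℕ} (hi : 1 ≤ i) (hj : 1 ≤ j) :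
    SameSide ν ν (shiftBy i ν) (shiftBy j ν) := by
  by_contra hcon
  set S : Set (Itinerary A) := (fun m => shiftBy m ν) '' Set.Iic (max i j + N)
  have : Finite S := (Set.finite_Iic _).image _
  have hgood : ∀ s : S, Good ν s.1 := by
    rintro ⟨_, m, -, rfl⟩
    exact good_of_ne_none fun i => hν _
  let r : Itinerary A := ν
  have hr : Good ν r := good_of_ne_none hν
  have hext : ∀ y : S, ∃ a : S, a.1 ≠ y.1 ∧ ¬ SameSide ν y.1 r a.1 := by
    rintro ⟨_, k, hk, rfl⟩
    obtain ⟨m, hm, h1, h2⟩ := track_self_bounded hN hi k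
    obtain ⟨m', hm', h1', h2'⟩ := track_self_bounded hN hj k
    by_contra! hc
    have e1 := hc ⟨shiftBy m ν, m, by simp only [Set.mem_Iic]; omega, rfl⟩ (fun h => h2 (h1.trans h))
    have e2 := hc ⟨shiftBy m' ν, m', by simp only [Set.mem_Iic]; omega, rfl⟩ (fun h => h2' (h1'.trans h))
    -- If both images were on the root's side of σᵏν, they would share a branch there, and this
    -- pulls back to ν.
    refine hcon (SameSide.of_shiftBy (n := k) ?_)
    rw [h1, h1']
    exact e1.symm.trans e2
  let R : S → S → Prop := fun a y => a.1 ≠ y.1 ∧ ¬ SameSide ν y.1 r a.1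
  have : IsTrans S R := ⟨by
    rintro a y x ⟨h1, h2⟩ ⟨h3, h4⟩
    refine ⟨fun h => ?_, fun h => ?_⟩
    · rw [h] at h2
      exact h2 (sameSide_of_not_sameSide (fun h => h3 h.symm) h4)
    · exact h2 (h.change_center hν (hgood x) hr h4)⟩
  have : Std.Irrefl R := ⟨fun a h => h.1 rfl⟩
  have wf : WellFounded R := Finite.wellFounded_of_trans_of_irrefl R
  obtain ⟨y, -, hy⟩ := wf.has_min Set.univ ⟨⟨ν, 0, by simp, rfl⟩, trivial⟩
  obtain ⟨a, ha⟩ := hext y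
  exact hy a trivial ha

/-! ### Inserted points -/

section inserted

variable {a b : Itinerary A} {m : ℕ}

theorem insertedPoint_apply_of_lt {i : ℕ} (h : i < m) :
    insertedPoint ν a b m i = (a i).or (b i) := by
  simp [insertedPoint, h]

theorem insertedPoint_self : insertedPoint ν a b m m = none := by simp [insertedPoint]

theorem shiftBy_insertedPoint : shiftBy (m + 1) (insertedPoint ν a b m) = ν := by
  funext i
  simp [shiftBy, insertedPoint, show ¬ i + (m + 1) < m by omega, show ¬ i + (m + 1) = m by omega]

theorem insertedPoint_agree_left {i : ℕ} (hi : i < m) :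
    a i = none ∨ a i = insertedPoint ν a b m i := by
  rw [insertedPoint_apply_of_lt hi]
  cases ha : a i <;> simp

theorem insertedPoint_agree_right (h : Agree a b m) {i : ℕ} (hi : i < m) :
    b i = none ∨ b i = insertedPoint ν a b m i := by
  rw [insertedPoint_apply_of_lt hi]
  rcases h i hi with h | h | h
  · simp [h]
  · simp [h]
  · cases hb : b i <;> simp [h, hb]

/-- A ⋆ in the word would be a ⋆ of both `a` and `b` after agreeing prefixes, which makes them the
same precritical point. -/
theorem isPrecritical_insertedPoint (hν : ∀ i, ν i ≠ none) (ha : Good ν a) (hb : Good ν b)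
    (hab : a ≠ b) (h : Agree a b m) : IsPrecritical ν m (insertedPoint ν a b m) := by
  refine ⟨fun i hi hn => ?_, insertedPoint_self, shiftBy_insertedPoint⟩
  rw [insertedPoint_apply_of_lt hi, Option.or_eq_none_iff] at hn
  exact hab (ha.ext hν hb (h.mono hi.le) hn.1 hn.2)

theorem agree_insertedPoint_left :
    Agree a (insertedPoint ν a b m) (m + 1) := by
  intro i hi
  rcases Nat.lt_succ_iff_lt_or_eq.1 hi with hi | rfl
  · exact (insertedPoint_agree_left hi).imp id Or.inr
  · exact Or.inr (Or.inl insertedPoint_self)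

theorem agree_insertedPoint_right (h : Agree a b m) :
    Agree (insertedPoint ν a b m) b (m + 1) := by
  refine Agree.symm fun i hi => ?_
  rcases Nat.lt_succ_iff_lt_or_eq.1 hi with hi | rfl
  · exact (insertedPoint_agree_right h hi).imp id Or.inr
  · exact Or.inr (Or.inl insertedPoint_self)

/-- There is no common hit before position `m`, at `m` the symbols of `a` and `b` differ, and after
`m` everything follows ν. -/
theorem not_sameSide_insertedPoint (hν : ∀ i, ν i ≠ none) (ha : Good ν a) (hb : Good ν b)
    (hab : a ≠ b) (h : Agree a b m) (hm : a m ≠ b m) :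
    ¬ SameSide ν (insertedPoint ν a b m) a b := by
  have hp := isPrecritical_insertedPoint hν ha hb hab h
  rintro ⟨t, h1, h2, h3⟩
  rcases lt_trichotomy t m with ht | rfl | ht
  · have e1 := track_eq_shiftBy ha (n := t) fun i hi =>
      insertedPoint_agree_left (ν := ν) (b := b) (hi.trans ht)
    have e2 := track_eq_shiftBy hb (n := t) fun i hi =>
      insertedPoint_agree_right (ν := ν) h (hi.trans ht)
    rw [Hit, e1, shiftBy, Nat.zero_add] at h1
    rw [Hit, e2, shiftBy, Nat.zero_add] at h2
    have f1 := (insertedPoint_agree_left (ν := ν) (b := b) ht).resolve_right h1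
    have f2 := (insertedPoint_agree_right (ν := ν) h ht).resolve_right h2
    exact hab (ha.ext hν hb (h.mono ht.le) f1 f2)
  · have e1 := track_eq_shiftBy ha (n := t) fun i hi =>
      insertedPoint_agree_left (ν := ν) (b := b) hi
    have e2 := track_eq_shiftBy hb (n := t) fun i hi =>
      insertedPoint_agree_right (ν := ν) h hi
    rw [e1, e2, shiftBy, shiftBy, Nat.zero_add] at h3
    exact hm (h3 hp.2.1)
  · exact not_hit_of_none hν (hp.good hν) ha hp.2.1 ht h1

/-- A point between `a` and `b` has the common symbols of `a` and `b`. -/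
theorem agree_of_not_sameSide (hν : ∀ i, ν i ≠ none) {z : Itinerary A} (ha : Good ν a)
    (hb : Good ν b) (hz : Good ν z) (hza : a ≠ z) (hzb : b ≠ z)
    (hab : Agree a b m) (h : ¬ SameSide ν z a b) {t : ℕ} (ht : t < m) :
    z t ≠ none ∧ (a t = none ∨ a t = z t) ∧ (b t = none ∨ b t = z t) := by
  induction t using Nat.strong_induction_on with
  | _ t ih =>
    have e1 : track ν z a t 0 = a t := by
      rw [track_eq_shiftBy ha fun i hi => (ih i hi (hi.trans ht)).2.1, shiftBy, Nat.zero_add]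
    have e2 : track ν z b t 0 = b t := by
      rw [track_eq_shiftBy hb fun i hi => (ih i hi (hi.trans ht)).2.2, shiftBy, Nat.zero_add]
    have key : ¬ (a t ≠ z t ∧ b t ≠ z t ∧ (z t = none → a t = b t)) := fun ⟨h1, h2, h3⟩ =>
      h ⟨t, by rwa [Hit, e1], by rwa [Hit, e2], by rwa [e1, e2]⟩
    by_cases hzt : z t = none
    · have h1 : a t ≠ none := fun h =>
        hza (ha.ext hν hz (fun i hi => (ih i hi (hi.trans ht)).2.1.imp id Or.inr) h hzt)
      have h2 : b t ≠ none := fun h =>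
        hzb (hb.ext hν hz (fun i hi => (ih i hi (hi.trans ht)).2.2.imp id Or.inr) h hzt)
      refine absurd ⟨by rwa [hzt], by rwa [hzt], fun _ => ?_⟩ key
      exact ((hab t ht).resolve_left h1).resolve_left h2
    · refine ⟨hzt, ?_⟩
      have key : a t = z t ∨ b t = z t := by
        by_contra! hc
        exact key ⟨hc.1, hc.2, fun h => absurd h hzt⟩
      rcases key with h1 | h1
      · refine ⟨Or.inr h1, ?_⟩
        rcases hab t ht with h | h | h
        · exact absurd (h1.symm.trans h) hzt
        · exact Or.inl h
        · exact Or.inr (h.symm.trans h1)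
      · refine ⟨?_, Or.inr h1⟩
        rcases hab t ht with h | h | h
        · exact Or.inl h
        · exact absurd (h1.symm.trans h) hzt
        · exact Or.inr (h.trans h1)

end inserted

/-- A point between two points of the arc from `c` to `d` lies on this arc. -/
theorem not_sameSide_of_convex (hν : ∀ i, ν i ≠ none) {z a b c d : Itinerary A} (hz : Good ν z)
    (hc : Good ν c) (ha : ¬ SameSide ν a c d) (hb : ¬ SameSide ν b c d)
    (h : ¬ SameSide ν z a b) : ¬ SameSide ν z c d := by
  intro hcd
  have h1 : SameSide ν z c a := by
    by_contra hn
    exact ha (hcd.change_center hν hz hc hn)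
  have h2 : SameSide ν z c b := by
    by_contra hn
    exact hb (hcd.change_center hν hz hc hn)
  exact h (h1.symm.trans h2)

/-! ### The critical path -/

theorem inserted_eq {a b : Itinerary A} {m : ℕ} (hd : diff a b = ((m + 1 : ℕ) : ℕ∞)) :
    inserted ν a b = [insertedPoint ν a b m] := by
  rw [inserted, hd, if_neg (ENat.natCast_ne_top _), ENat.toNat_natCast, Nat.add_sub_cancel]

/-- The new point is a neighbour of both neighbours between which it is inserted. -/
theorem infix_insertAll {a b : Itinerary A} {m : ℕ} (hd : diff a b = ((m + 1 : ℕ) : ℕ∞))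
    {l : List (Itinerary A)} (h : [a, b] <:+: l) :
    [a, insertedPoint ν a b m, b] <:+: insertAll ν l := by
  have hhead : ∀ c (l : List (Itinerary A)), ∃ l', insertAll ν (c :: l) = c :: l' := by
    intro c l
    cases l with
    | nil => exact ⟨[], rfl⟩
    | cons d l => exact ⟨_, rfl⟩
  obtain ⟨l1, l2, rfl⟩ := h
  induction l1 with
  | nil =>
    obtain ⟨l', hl'⟩ := hhead b l2
    refine ⟨[], l', ?_⟩
    simp only [List.nil_append, List.cons_append, insertAll, inserted_eq hd, hl']
  | cons c l1 ih =>
    have : ∃ d l3, l1 ++ [a, b] ++ l2 = d :: l3 := by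
      cases l1 with
      | nil => exact ⟨a, _, rfl⟩
      | cons d l => exact ⟨d, _, rfl⟩
    obtain ⟨d, l3, hl3⟩ := this
    rw [hl3] at ih
    rw [List.cons_append, List.cons_append, hl3, insertAll]
    exact ih.trans ((List.suffix_append _ _).trans (List.suffix_cons _ _)).isInfix

theorem IsPrecritical.isPoint {n : ℕ} {x : Itinerary A} (h : IsPrecritical ν n x) :
    IsPoint ν x := Or.inr (Or.inl ⟨n, h⟩)

theorem isPoint_criticalPoint : IsPoint ν (criticalPoint ν) :=
  isPrecritical_criticalPoint.isPoint

theorem insertedPoint_ne {a b : Itinerary A} {m : ℕ} (h : a m ≠ none) :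
    a ≠ insertedPoint ν a b m := by
  intro he
  rw [he] at h
  exact h insertedPoint_self

theorem insertedPoint_ne' {a b : Itinerary A} {m : ℕ} (h : b m ≠ none) :
    insertedPoint ν a b m ≠ b := by
  intro he
  rw [← he] at h
  exact h insertedPoint_self

/-- The points of `X_ν` on the arc from the critical point to the critical value. -/
def OnPath (ν x : Itinerary A) : Prop :=
  IsPoint ν x ∧ ¬ SameSide ν x (criticalPoint ν) ν

/-- Neighbours stay distinct, so a point is inserted in every gap; the statement about the head
makes the induction able to join the new points to the rest of the list. -/
theorem chain_insertAll (hν : ∀ i, ν i ≠ none) (hp : ∀ n, 1 ≤ n → shiftBy n ν ≠ ν)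
    {l : List (Itinerary A)} (h1 : l.IsChain (· ≠ ·)) (h2 : ∀ x ∈ l, OnPath ν x) :
    (insertAll ν l).IsChain (· ≠ ·) ∧ (insertAll ν l).head? = l.head? ∧
      ∀ x ∈ insertAll ν l, OnPath ν x := by
  induction l with
  | nil => exact ⟨h1, rfl, h2⟩
  | cons a l ih =>
    cases l with
    | nil => exact ⟨h1, rfl, h2⟩
    | cons b l =>
      rw [List.isChain_cons_cons] at h1
      obtain ⟨hab, h1⟩ := h1
      obtain ⟨i1, i2, i3⟩ := ih h1 fun x hx => h2 x (List.mem_cons_of_mem _ hx)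
      have ha := h2 a (by simp)
      have hb := h2 b (by simp)
      have hag := ha.1.good hν
      have hbg := hb.1.good hν
      have hd : ∃ i, ¬ (a i = none ∨ b i = none ∨ a i = b i) := by
        by_contra! hc
        exact hab (ha.1.ext hν hp hb.1 fun k i _ => hc i)
      obtain ⟨m, hm, h3, h4, h5, h6⟩ := exists_first_diff hd
      have hpre := isPrecritical_insertedPoint hν hag hbg hab h3
      obtain ⟨l', hl'⟩ : ∃ l', insertAll ν (b :: l) = b :: l' := by
        cases he : insertAll ν (b :: l) with
        | nil => simp [he] at i2
        | cons c l' =>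
          simp only [he, List.head?_cons, Option.some.injEq] at i2
          exact ⟨l', by rw [i2]⟩
      have he : insertAll ν (a :: b :: l) = a :: insertedPoint ν a b m :: b :: l' := by
        rw [insertAll, inserted_eq hm, hl']
        rfl
      rw [hl'] at i1 i3
      rw [he]
      refine ⟨?_, rfl, ?_⟩
      · rw [List.isChain_cons_cons, List.isChain_cons_cons]
        exact ⟨insertedPoint_ne h4, insertedPoint_ne' h5, i1⟩
      · intro x hx
        rcases List.mem_cons.1 hx with rfl | hx
        · exact ha
        rcases List.mem_cons.1 hx with rfl | hx
        · exact ⟨hpre.isPoint, not_sameSide_of_convex hν (hpre.good hν)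
            (isPoint_criticalPoint.good hν) ha.2 hb.2
            (not_sameSide_insertedPoint hν hag hbg hab h3 h6)⟩
        · exact i3 x hx

theorem criticalPoint_ne (hν : ∀ i, ν i ≠ none) : criticalPoint ν ≠ ν := by
  intro h
  exact hν 0 (congrFun h 0).symm

theorem precriticalList_spec (hν : ∀ i, ν i ≠ none) (hp : ∀ n, 1 ≤ n → shiftBy n ν ≠ ν)
    (n : ℕ) : (precriticalList ν n).IsChain (· ≠ ·) ∧
      ∀ x ∈ precriticalList ν n, OnPath ν x := by
  induction n with
  | zero =>
    constructor
    · simpa [precriticalList] using criticalPoint_ne hν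
    · intro x hx
      simp only [precriticalList, List.mem_cons, List.not_mem_nil, or_false] at hx
      rcases hx with rfl | rfl
      · exact ⟨isPoint_criticalPoint, not_sameSide_left _ _⟩
      · exact ⟨isPoint_self, not_sameSide_right _ _⟩
  | succ n ih =>
    obtain ⟨h1, -, h2⟩ := chain_insertAll hν hp ih.1 ih.2
    exact ⟨h1, h2⟩

/-- A point of the arc is listed, or lies between neighbours that agree at many positions. -/
theorem exists_neighbours (hν : ∀ i, ν i ≠ none) (hp : ∀ n, 1 ≤ n → shiftBy n ν ≠ ν)
    {z : Itinerary A} (hz : ¬ SameSide ν z (criticalPoint ν) ν) (k : ℕ) :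
    ∃ a b, [a, b] <:+: precriticalList ν k ∧ Agree a b k ∧ ¬ SameSide ν z a b := by
  induction k with
  | zero => exact ⟨_, _, ⟨[], [], rfl⟩, fun i hi => absurd hi (by omega), hz⟩
  | succ k ih =>
    obtain ⟨a, b, h1, h2, h3⟩ := ih
    obtain ⟨hch, hon⟩ := precriticalList_spec hν hp k
    have hab : a ≠ b := by
      have := hch.infix h1
      simpa using this
    have ha := hon a (h1.subset (by simp))
    have hb := hon b (h1.subset (by simp))
    have hd : ∃ i, ¬ (a i = none ∨ b i = none ∨ a i = b i) := by
      by_contra! hc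
      exact hab (ha.1.ext hν hp hb.1 fun k i _ => hc i)
    obtain ⟨m, hm, h4, h5, h6, h7⟩ := exists_first_diff hd
    have hkm : k ≤ m := by
      by_contra hlt
      rcases h2 m (by omega) with h | h | h <;> contradiction
    have hinf := infix_insertAll (ν := ν) hm h1
    -- The new point halves the arc, and the half containing `z` is kept.
    by_cases hc : SameSide ν z a (insertedPoint ν a b m)
    · refine ⟨insertedPoint ν a b m, b, ?_, agree_insertedPoint_right h4 |>.mono (by omega),
        fun h => h3 (hc.trans h)⟩
      exact (List.suffix_cons a _).isInfix.trans hinf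
    · refine ⟨a, insertedPoint ν a b m, ?_, agree_insertedPoint_left |>.mono (by omega), hc⟩
      exact List.IsInfix.trans ⟨[], [b], rfl⟩ hinf

/-- Neighbours of generation `n + 1` agree on `n + 1` entries, so a point strictly between them
cannot have ⋆ at position `n`. -/
theorem mem_pathPrecritical (hν : ∀ i, ν i ≠ none) (hp : ∀ n, 1 ≤ n → shiftBy n ν ≠ ν)
    {z : X ν} {n : ℕ} (hn : z.seq n = none) (hz : ¬ SameSide ν z.seq (criticalPoint ν) ν) :
    z ∈ pathPrecritical ν := by
  obtain ⟨a, b, h1, h2, h3⟩ := exists_neighbours hν hp hz (n + 1)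
  have hon := (precriticalList_spec hν hp (n + 1)).2
  have ha := h1.subset (a := a) (by simp)
  have hb := h1.subset (a := b) (by simp)
  by_cases hza : a = z.seq
  · exact ⟨_, hza ▸ ha⟩
  by_cases hzb : b = z.seq
  · exact ⟨_, hzb ▸ hb⟩
  exact absurd hn (agree_of_not_sameSide hν ((hon a ha).1.good hν) ((hon b hb).1.good hν)
    (z.2.good hν) hza hzb h2 h3 (Nat.lt_succ_self n)).1

theorem mem_criticalPath (hν : ∀ i, ν i ≠ none) (hp : ∀ n, 1 ≤ n → shiftBy n ν ≠ ν)
    {z : X ν} (hz : ¬ SameSide ν z.seq (criticalPoint ν) ν) : z ∈ criticalPath ν := by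
  by_cases hn : ∃ n, z.seq n = none
  · obtain ⟨n, hn⟩ := hn
    exact Or.inl (mem_pathPrecritical hν hp hn hz)
  push Not at hn
  by_cases hc : z ∈ pathPrecritical ν
  · exact Or.inl hc
  refine Or.inr ⟨hn, fun k => ?_⟩
  obtain ⟨a, b, h1, h2, h3⟩ := exists_neighbours hν hp hz k
  have hon := (precriticalList_spec hν hp k).2
  have ha := h1.subset (a := a) (by simp)
  have hb := h1.subset (a := b) (by simp)
  have hza : a ≠ z.seq := fun h => hc ⟨_, h ▸ ha⟩
  have hzb : b ≠ z.seq := fun h => hc ⟨_, h ▸ hb⟩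
  refine ⟨⟨a, (hon a ha).1⟩, ⟨k, ha⟩, le_diff_iff.2 fun i hi => ?_⟩
  exact (agree_of_not_sameSide hν ((hon a ha).1.good hν) ((hon b hb).1.good hν)
    (z.2.good hν) hza hzb h2 h3 (show i < k by omega)).2.1.imp id Or.inr

theorem exists_uniform_bound {P : ℕ → ℕ → Prop} (hmono : ∀ n K K', K ≤ K' → P n K → P n K')
    (h : ∀ n, ∃ K, P n K) (k : ℕ) : ∃ K, ∀ n < k, P n K := by
  induction k with
  | zero => exact ⟨0, by simp⟩
  | succ k ih =>
    obtain ⟨K, hK⟩ := ih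
    obtain ⟨K', hK'⟩ := h k
    refine ⟨max K K', fun n hn => ?_⟩
    rcases Nat.lt_succ_iff_lt_or_eq.1 hn with hn | rfl
    · exact hmono n _ _ (le_max_left _ _) (hK n hn)
    · exact hmono n _ _ (le_max_right _ _) hK'

theorem not_sameSide_of_mem_criticalPath (hν : ∀ i, ν i ≠ none)
    (hp : ∀ n, 1 ≤ n → shiftBy n ν ≠ ν) {x : X ν} (hx : x ∈ criticalPath ν) :
    ¬ SameSide ν x.seq (criticalPoint ν) ν := by
  rcases hx with ⟨n, hn⟩ | ⟨hx, hlim⟩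
  · exact ((precriticalList_spec hν hp n).2 _ hn).2
  rintro ⟨t, h1, h2, -⟩
  -- No early tail of the limit `x` is ν, and this is visible within `K` entries. Close approximants
  -- therefore have no ⋆ up to position `t`, so they have the same symbols as `x` there and inherit
  -- its common hit.
  obtain ⟨K, hK⟩ := exists_uniform_bound
    (P := fun l K => ∃ j, j + (l + 1) < K ∧ x.seq (j + (l + 1)) ≠ ν j)
    (fun n K K' hKK' ⟨j, hj, h⟩ => ⟨j, by omega, h⟩) (fun l => by
      have : shiftBy (l + 1) x.seq ≠ ν := fun h => hx l (x.2.isPrecritical hν hp h).2.1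
      obtain ⟨j, hj⟩ := Function.ne_iff.1 this
      exact ⟨_, j, Nat.lt_succ_self _, hj⟩) (t + 1)
  obtain ⟨a, ⟨n, ha⟩, hak⟩ := hlim (K + t + 2)
  have hak := le_diff_iff.1 hak
  have hon := (precriticalList_spec hν hp n).2 _ ha
  have heq : ∀ l < t + 1, a.seq l = x.seq l ∧ a.seq l ≠ none := by
    intro l hl
    have hal : a.seq l ≠ none := by
      intro h
      obtain ⟨j, hj, hne⟩ := hK l hl
      have h3 := congrFun (a.2.good hν l h) j
      rw [shiftBy] at h3
      rcases hak (j + (l + 1)) (by omega) with h | h | h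
      · exact hν j (h3.symm.trans h)
      · exact hx _ h
      · exact hne (h.symm.trans h3)
    exact ⟨((hak l (by omega)).resolve_left hal).resolve_left (hx l), hal⟩
  refine hon.2 ⟨t, ?_, ?_, fun h => absurd h (heq t (by omega)).2⟩
  · rw [Hit, track_congr fun i hi => (heq i (by omega)).1, (heq t (by omega)).1]
    exact h1
  · rw [Hit, track_congr fun i hi => (heq i (by omega)).1, (heq t (by omega)).1]
    exact h2

/-! ### Convexity of the Hubbard tree -/

/-- The point `h` of `X_ν` represents the sequence `z`: it is equal to `z`, or `h = w⋆ν` and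
`z = weν` for a symbol `e`. -/
def Represents (ν z h : Itinerary A) : Prop :=
  h = z ∨ ∃ n, IsPrecritical ν n h ∧ ∀ i, i ≠ n → z i = h i

theorem Represents.shift {z h : Itinerary A} (hr : Represents ν z h) :
    Represents ν (shiftBy 1 z) (shiftBy 1 h) := by
  rcases hr with rfl | ⟨n, hn, hz⟩
  · exact Or.inl rfl
  · cases n with
    | zero => exact Or.inl (funext fun i => (hz (i + 1) (by omega)).symm)
    | succ n =>
      refine Or.inr ⟨n, ⟨fun i hi => hn.1 (i + 1) (by omega), hn.2.1, ?_⟩,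
        fun i hi => hz (i + 1) (by omega)⟩
      rw [shiftBy_shiftBy]
      exact hn.2.2

open Classical in
-- Only `z` = weν needs an argument: if w⋆ν were off the path, both ends would cross it with the
-- same symbol. If that symbol is not e, they share a hit with `z`; if it is e, they continue as
-- iterates of ν, which lie in one branch at the endpoint ν. Either way `z` would be off the path as
-- well.
theorem exists_represents_of_not_sameSide (hν : ∀ i, ν i ≠ none) {N : ℕ}
    (hN : ∀ n, 1 ≤ n → ∃ i < N, ν i ≠ ν (i + n)) (hp : ∀ n, 1 ≤ n → shiftBy n ν ≠ ν)
    {z : Itinerary A} (hz : Good ν z) (h : ¬ SameSide ν z (criticalPoint ν) ν) :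
    ∃ x ∈ criticalPath ν, Represents ν z x.seq := by
  by_cases hzX : IsPoint ν z
  · exact ⟨⟨z, hzX⟩, mem_criticalPath hν hp h, Or.inl rfl⟩
  have hz0 : ∀ i, z i ≠ none := fun i hi => hzX (hz.isPrecritical hν hi).isPoint
  have hm : ∃ m, shiftBy (m + 1) z = ν := by
    by_contra! hc
    refine hzX (Or.inr (Or.inr ⟨hz0, fun n hn => ?_⟩))
    obtain ⟨m, rfl⟩ := Nat.exists_eq_add_of_le' hn
    exact hc m
  obtain ⟨m, hm⟩ := hm
  let w : Itinerary A := fun i => if i = m then none else z i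
  have hwz : ∀ i, i ≠ m → w i = z i := fun i hi => if_neg hi
  have hwm : w m = none := if_pos rfl
  have hpre : IsPrecritical ν m w := by
    refine ⟨fun i hi => by rw [hwz i (by omega)]; exact hz0 i, hwm, ?_⟩
    rw [← hm]
    funext i
    exact hwz _ (by omega)
  refine ⟨⟨w, hpre.isPoint⟩, mem_criticalPath hν hp ?_, Or.inr ⟨m, hpre,
    fun i hi => (hwz i hi).symm⟩⟩
  rintro ⟨t, h1, h2, h3⟩
  have hc : ∀ i < m, w i = z i := fun i hi => hwz i (by omega)
  rcases lt_trichotomy t m with ht | rfl | ht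
  · have hc' : ∀ i < t, w i = z i := fun i hi => hc i (by omega)
    have h1 : Hit ν w (criticalPoint ν) t := h1
    have h2 : Hit ν w ν t := h2
    rw [Hit, track_congr hc', hc t ht] at h1 h2
    exact h ⟨t, h1, h2, fun h => absurd h (hz0 t)⟩
  · have h1 : Hit ν w (criticalPoint ν) t := h1
    have h3 : track ν w (criticalPoint ν) t 0 = track ν w ν t 0 := h3 hwm
    rw [Hit, track_congr hc, hwm] at h1
    rw [track_congr hc, track_congr hc] at h3
    by_cases hzt : Hit ν z (criticalPoint ν) t
    · exact h ⟨t, hzt, by rwa [Hit, ← h3], fun h => absurd h (hz0 t)⟩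
    have hzt' : ¬ Hit ν z ν t := by rwa [Hit, ← h3]
    obtain ⟨i, hi⟩ : ∃ i, track ν z (criticalPoint ν) t = shiftBy i ν := by
      cases t with
      | zero => exact absurd rfl h1
      | succ t => exact exists_track_criticalPoint z t
    obtain ⟨j, hj⟩ := exists_track_shiftBy (ν := ν) z 0 t
    rw [shiftBy_zero] at hj
    refine h (SameSide.of_shiftBy (n := t + 1) ?_)
    rw [hm, track_succ_of_not_hit hzt, track_succ_of_not_hit hzt', hi, hj, shiftBy_shiftBy,
      shiftBy_shiftBy]
    exact sameSide_critical_value hν hN (by omega) (by omega)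
  · exact not_hit_of_none hν (hpre.good hν) (isPoint_criticalPoint.good hν) hwm ht h1

theorem seq_shift_iterate (x : X ν) (n : ℕ) : (X.shift^[n] x).seq = shiftBy n x.seq := by
  induction n with
  | zero => rfl
  | succ n ih =>
    rw [Function.iterate_succ_apply', X.seq, X.shift]
    change shiftBy 1 (X.seq _) = _
    rw [ih, shiftBy_shiftBy, Nat.add_comm]

/-- The critical value as a point of `X_ν`. -/
def criticalValue (ν : Itinerary A) : X ν := ⟨ν, isPoint_self⟩

theorem criticalValue_mem : criticalValue ν ∈ criticalPath ν :=
  Or.inl ⟨0, by simp [precriticalList, criticalValue, X.seq]⟩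

theorem shift_mem_hubbardTree {x : X ν} (hx : x ∈ hubbardTree ν) : x.shift ∈ hubbardTree ν := by
  obtain ⟨n, y, hy, rfl⟩ := Set.mem_iUnion.1 hx
  exact Set.mem_iUnion.2 ⟨n + 1, y, hy, Function.iterate_succ_apply' _ _ _⟩

theorem criticalPath_subset : criticalPath ν ⊆ hubbardTree ν :=
  fun x hx => Set.mem_iUnion.2 ⟨0, x, hx, rfl⟩

/-- The sequence `az`. -/
def prepend (a : Option A) (z : Itinerary A) : Itinerary A
  | 0 => a
  | i + 1 => z i

/-- The arc from σx' to ν is lifted to the arc from x' to the critical point by prepending the first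
symbol of x'. The lifted arc is covered by the arc from x' to ν, treated by induction, and the
critical path. -/
theorem exists_represents_criticalValue (hν : ∀ i, ν i ≠ none) {N : ℕ}
    (hN : ∀ n, 1 ≤ n → ∃ i < N, ν i ≠ ν (i + n)) (hp : ∀ n, 1 ≤ n → shiftBy n ν ≠ ν)
    (n : ℕ) {x : X ν} (hx : x ∈ criticalPath ν) {z : Itinerary A} (hz : Good ν z)
    (h : ¬ SameSide ν z (shiftBy n x.seq) ν) :
    ∃ y ∈ hubbardTree ν, Represents ν z y.seq := by
  have base : ∀ {z a b : Itinerary A}, Good ν z → ¬ SameSide ν a (criticalPoint ν) ν →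
      ¬ SameSide ν b (criticalPoint ν) ν → ¬ SameSide ν z a b →
      ∃ y ∈ hubbardTree ν, Represents ν z y.seq := by
    intro z a b hz ha hb h
    obtain ⟨y, hy, hr⟩ := exists_represents_of_not_sameSide hν hN hp hz
      (not_sameSide_of_convex hν hz (isPoint_criticalPoint.good hν) ha hb h)
    exact ⟨y, criticalPath_subset hy, hr⟩
  induction n generalizing z with
  | zero =>
    exact base hz (not_sameSide_of_mem_criticalPath hν hp hx) (not_sameSide_right _ _) h
  | succ n ih =>
    by_cases hzν : z = ν
    · exact ⟨criticalValue ν, criticalPath_subset criticalValue_mem, Or.inl hzν.symm⟩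
    set x' := shiftBy n x.seq with hx'
    have hs : shiftBy (n + 1) x.seq = shiftBy 1 x' := by
      rw [hx', shiftBy_shiftBy, Nat.add_comm]
    rw [hs] at h
    have hxg : Good ν x' := (x.2.good hν).shifted n
    have ha : x' 0 ≠ none := by
      intro h0
      rw [hxg 0 h0] at h
      exact h (SameSide.refl (Ne.symm hzν))
    let w := prepend (x' 0) z
    have hw : Good ν w := by
      intro i hi
      cases i with
      | zero => exact absurd hi ha
      | succ i => exact hz i hi
    have hsw : shiftBy 1 w = z := rfl
    have key : ¬ SameSide ν w x' (criticalPoint ν) := by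
      have n1 : ¬ Hit ν w x' 0 := not_not.2 rfl
      have n2 : Hit ν w (criticalPoint ν) 0 := Ne.symm ha
      rintro ⟨t, h1, h2, h3⟩
      cases t with
      | zero => exact n1 h1
      | succ t =>
        rw [Nat.add_comm] at h1 h2 h3
        rw [hit_add, track_succ_of_not_hit n1, hsw] at h1
        rw [hit_add, track_succ_of_hit n2, hsw] at h2
        rw [track_add, track_add, track_succ_of_not_hit n1, track_succ_of_hit n2, hsw] at h3
        refine h ⟨t, h1, h2, fun hzt => h3 ?_⟩
        rw [Nat.add_comm]
        exact hzt
    have : ∃ y ∈ hubbardTree ν, Represents ν w y.seq := by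
      by_cases hc : SameSide ν w x' ν
      · exact base hw (not_sameSide_left _ _) (not_sameSide_right _ _)
          fun h => key (hc.trans h.symm)
      · exact ih hw hc
    obtain ⟨y, hy, hr⟩ := this
    exact ⟨y.shift, shift_mem_hubbardTree hy, hr.shift⟩

/-- Every sequence between two points of the Hubbard tree is represented in the tree. -/
theorem exists_represents (hν : ∀ i, ν i ≠ none) {N : ℕ}
    (hN : ∀ n, 1 ≤ n → ∃ i < N, ν i ≠ ν (i + n)) (hp : ∀ n, 1 ≤ n → shiftBy n ν ≠ ν)
    {x y : X ν} (hx : x ∈ hubbardTree ν) (hy : y ∈ hubbardTree ν) {z : Itinerary A}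
    (hz : Good ν z) (h : ¬ SameSide ν z x.seq y.seq) :
    ∃ w ∈ hubbardTree ν, Represents ν z w.seq := by
  obtain ⟨n, x, hx', rfl⟩ := Set.mem_iUnion.1 hx
  obtain ⟨m, y, hy', rfl⟩ := Set.mem_iUnion.1 hy
  rw [seq_shift_iterate, seq_shift_iterate] at h
  by_cases hc : SameSide ν z (shiftBy n x.seq) ν
  · exact exists_represents_criticalValue hν hN hp m hy' hz fun h' => h (hc.trans h'.symm)
  · exact exists_represents_criticalValue hν hN hp n hx' hz hc

/-! ### The topology -/

/-- Precritical points of a given depth do not accumulate: unless `a` is one itself, its tail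
differs from ν at a definite position. -/
theorem exists_not_isPrecritical (hν : ∀ i, ν i ≠ none) (hp : ∀ n, 1 ≤ n → shiftBy n ν ≠ ν)
    (a : X ν) (k : ℕ) : ∃ K, ∀ n < k, ∀ b : X ν, Agree a.seq b.seq K → b ≠ a →
      ¬ IsPrecritical ν n b.seq := by
  refine exists_uniform_bound (P := fun n K => ∀ b : X ν, Agree a.seq b.seq K → b ≠ a →
      ¬ IsPrecritical ν n b.seq) (fun n K K' hKK' h b hb => h b (hb.mono hKK')) (fun n => ?_) k
  by_cases ha : IsPrecritical ν n a.seq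
  · refine ⟨n, fun b hab hne hb => hne (Subtype.ext ?_)⟩
    exact ((a.2.good hν).ext hν (b.2.good hν) hab ha.2.1 hb.2.1).symm
  · have hne : shiftBy (n + 1) a.seq ≠ ν := fun h => ha (a.2.isPrecritical hν hp h)
    have : ∃ j, ¬ (a.seq (j + (n + 1)) = none ∨ ν j = none ∨ a.seq (j + (n + 1)) = ν j) := by
      by_contra! hc
      exact hne ((isPoint_shiftBy a.2 _).ext hν hp isPoint_self fun k j _ => hc j)
    obtain ⟨j, hj⟩ := this
    refine ⟨j + (n + 1) + 1, fun b hab _ hb => hj ?_⟩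
    have := congrFun hb.2.2 j
    rw [shiftBy] at this
    rw [← this]
    exact hab _ (Nat.lt_succ_self _)

/-- Every neighbourhood of `a` contains all points that agree with `a` at many positions. -/
theorem exists_agree_of_isOpen (hν : ∀ i, ν i ≠ none) (hp : ∀ n, 1 ≤ n → shiftBy n ν ≠ ν)
    {V : Set (X ν)} (hV : IsOpen V) {a : X ν} (ha : a ∈ V) :
    ∃ K, ∀ b : X ν, Agree a.seq b.seq K → b ∈ V := by
  change TopologicalSpace.GenerateOpen _ V at hV
  induction hV with
  | univ => exact ⟨0, fun b _ => trivial⟩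
  | inter s t _ _ ihs iht =>
    obtain ⟨K, hK⟩ := ihs ha.1
    obtain ⟨K', hK'⟩ := iht ha.2
    exact ⟨max K K', fun b hb =>
      ⟨hK b (hb.mono (le_max_left _ _)), hK' b (hb.mono (le_max_right _ _))⟩⟩
  | sUnion S _ ih =>
    obtain ⟨s, hs, has⟩ := ha
    obtain ⟨K, hK⟩ := ih s hs has
    exact ⟨K, fun b hb => ⟨s, hs, hK b hb⟩⟩
  | basic s hs =>
    obtain ⟨c, k, -, rfl⟩ := hs
    obtain ⟨K, hK⟩ := exists_not_isPrecritical hν hp a k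
    refine ⟨max K k, fun b hb => ?_⟩
    have hbK := hb.mono (le_max_left K k)
    have hbk := hb.mono (le_max_right K k)
    have hac := le_diff_iff.1 ha.1
    -- Removing the boundary ensures that `a` has no ⋆ among the relevant entries, and so agreement
    -- with `c` passes through `a`.
    have hnp : a ≠ c → ∀ n, n + 1 < k → ¬ IsPrecritical ν n a.seq := fun hne n hn hn' =>
      ha.2 ⟨ha.1, hne, fun h => hν n (h ▸ hn'.2.1), n, hn, hn'⟩
    refine ⟨le_diff_iff.2 fun i hi => ?_, ?_⟩
    · by_cases hne : a = c
      · rw [← hne]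
        exact hbk i (by omega)
      · have hai : a.seq i ≠ none := fun h =>
          hnp hne i (by omega) ((a.2.good hν).isPrecritical hν h)
        rcases hac i hi with h | h | h
        · exact Or.inl h
        · exact absurd h hai
        · rw [h]
          exact hbk i (by omega)
    · rintro ⟨-, hbc, -, n, hn, hn'⟩
      by_cases hba : b = a
      · subst hba
        exact hnp hbc n hn hn'
      · exact hK n (by omega) b hbK hba hn'

/-! ### Branches are connected -/

/-- The branch of the Hubbard tree at `τ` that contains `x`. -/
def branch (τ x : X ν) : Set (X ν) := {y | y ∈ hubbardTree ν ∧ SameSide ν τ.seq x.seq y.seq}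

theorem Represents.eq_of_isPrecritical (hν : ∀ i, ν i ≠ none) {z h : Itinerary A} {m : ℕ}
    (hr : Represents ν z h) (hh : Good ν h) (hz : IsPrecritical ν m z) : h = z := by
  rcases hr with rfl | ⟨n, hn, hzh⟩
  · rfl
  have hmn : m = n := by
    by_contra hne
    have hm := hh.isPrecritical hν ((hzh m hne).symm.trans hz.2.1)
    rcases Nat.lt_or_gt_of_ne hne with h' | h'
    · exact hn.1 m h' hm.2.1
    · exact hm.1 n h' hn.2.1
  funext i
  by_cases hi : i = n
  · rw [hi, hn.2.1, ← hmn, hz.2.1]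
  · exact (hzh i hi).symm

/-- The sequences weν and w⋆ν either leave `τ` together, or only the second is reset, at its ⋆. In
the latter case both continue as ν, which is separated from the tail of `τ`. -/
theorem Represents.sameSide {τ x z h : Itinerary A}
    (hτ : ∀ n, shiftBy n τ ≠ ν) (hτ0 : ∀ i, τ i ≠ none)
    (hr : Represents ν z h) (hz : SameSide ν τ x z) : SameSide ν τ x h := by
  classical
  rcases hr with rfl | ⟨n, hn, hzh⟩
  · exact hz
  refine hz.trans ?_
  have hex : ∃ t, h t ≠ τ t := ⟨n, by rw [hn.2.1]; exact (hτ0 n).symm⟩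
  have hts := Nat.find_spec hex
  have htm : ∀ i < Nat.find hex, h i = τ i := fun i hi => not_not.1 (Nat.find_min hex hi)
  have htn : Nat.find hex ≤ n := Nat.find_min' hex (by rw [hn.2.1]; exact (hτ0 n).symm)
  set t := Nat.find hex
  have e1 : track ν τ h t = shiftBy t h := track_eq_shiftBy_of_eq htm
  have e2 : track ν τ z t = shiftBy t z :=
    track_eq_shiftBy_of_eq fun i hi => (hzh i (by omega)).trans (htm i hi)
  have h1 : Hit ν τ h t := by rwa [Hit, e1, shiftBy, Nat.zero_add]
  by_cases h2 : Hit ν τ z t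
  · exact ⟨t, h2, h1, fun h => absurd h (hτ0 t)⟩
  · have htn : t = n := by
      by_contra hne
      refine h2 ?_
      rwa [Hit, e2, shiftBy, Nat.zero_add, hzh t hne]
    refine SameSide.of_shiftBy (n := t + 1) ?_
    have h3 : track ν τ z (t + 1) = ν := by
      rw [track_succ_of_not_hit h2, e2, shiftBy_shiftBy, Nat.add_comm, ← hn.2.2, ← htn]
      funext i
      exact hzh _ (by omega)
    rw [h3, track_succ_of_hit h1]
    exact SameSide.refl (Ne.symm (hτ _))

/-- Given a separation, pairs with one point in each open set are bisected by inserted points. The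
first difference moves out to infinity, and the representative of the limit is approximated from
both open sets. -/
theorem isPreconnected_branch (hν : ∀ i, ν i ≠ none) {N : ℕ}
    (hN : ∀ n, 1 ≤ n → ∃ i < N, ν i ≠ ν (i + n)) (hp : ∀ n, 1 ≤ n → shiftBy n ν ≠ ν)
    {τ : X ν} (hτ : ∀ n, shiftBy n τ.seq ≠ ν) (hτ0 : ∀ i, τ.seq i ≠ none) (x : X ν) :
    IsPreconnected (branch τ x) := by
  have hτg : Good ν τ.seq := τ.2.good hν
  rintro u v hu hv huv ⟨a₀, ha₀, hau⟩ ⟨b₀, hb₀, hbv⟩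
  by_contra hemp
  have hdisj : ∀ y ∈ branch τ x, y ∈ u → y ∉ v := fun y hy h1 h2 => hemp ⟨y, hy, h1, h2⟩
  let Q := {q : X ν × X ν // (q.1 ∈ branch τ x ∧ q.1 ∈ u) ∧ q.2 ∈ branch τ x ∧ q.2 ∈ v}
  have hmem : ∀ (q : Q) (z : Itinerary A), Good ν z → ¬ SameSide ν z q.1.1.seq q.1.2.seq →
      ∃ y ∈ branch τ x, Represents ν z y.seq := by
    rintro ⟨⟨a, b⟩, ⟨⟨haH, ha⟩, hau⟩, ⟨hbH, hb⟩, hbv⟩ z hz h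
    obtain ⟨y, hy, hr⟩ := exists_represents hν hN hp haH hbH hz h
    refine ⟨y, ⟨hy, hr.sameSide hτ hτ0 (ha.trans ?_)⟩, hr⟩
    by_contra hc
    exact h ((ha.symm.trans hb).change_center hν hτg (a.2.good hν) hc)
  have hstep : ∀ q : Q, ∃ (m : ℕ) (p : X ν) (q' : Q), ¬ Agree q.1.1.seq q.1.2.seq (m + 1) ∧
      (∀ i < m, p.seq i ≠ none ∧ (q.1.1.seq i = none ∨ q.1.1.seq i = p.seq i) ∧
        (q.1.2.seq i = none ∨ q.1.2.seq i = p.seq i)) ∧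
      ¬ SameSide ν p.seq q.1.1.seq q.1.2.seq ∧ Agree q'.1.1.seq q'.1.2.seq (m + 1) ∧
      (q'.1.1 = p ∧ q'.1.2 = q.1.2 ∨ q'.1.1 = q.1.1 ∧ q'.1.2 = p) := by
    intro q
    have hq := hmem q
    obtain ⟨⟨a, b⟩, ⟨ha, hau⟩, hb, hbv⟩ := q
    have hab : a.seq ≠ b.seq := fun h => hdisj a ha hau (by rwa [show a = b from Subtype.ext h])
    have hd : ∃ i, ¬ (a.seq i = none ∨ b.seq i = none ∨ a.seq i = b.seq i) := by
      by_contra! hc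
      exact hab (a.2.ext hν hp b.2 fun k i _ => hc i)
    obtain ⟨m, -, h3, h4, h5, h6⟩ := exists_first_diff hd
    have hag := a.2.good hν
    have hbg := b.2.good hν
    have hpre := isPrecritical_insertedPoint hν hag hbg hab h3
    have hns := not_sameSide_insertedPoint hν hag hbg hab h3 h6
    let p : X ν := ⟨insertedPoint ν a.seq b.seq m, hpre.isPoint⟩
    have hpb : p ∈ branch τ x := by
      obtain ⟨y, hy, hr⟩ := hq _ (hpre.good hν) hns
      rwa [show p = y from Subtype.ext (hr.eq_of_isPrecritical hν (y.2.good hν) hpre).symm]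
    have hagree : ∀ i < m, p.seq i ≠ none ∧ (a.seq i = none ∨ a.seq i = p.seq i) ∧
        (b.seq i = none ∨ b.seq i = p.seq i) := fun i hi =>
      ⟨hpre.1 i hi, insertedPoint_agree_left hi, insertedPoint_agree_right h3 hi⟩
    have hnA : ¬ Agree a.seq b.seq (m + 1) := fun h => by
      rcases h m (Nat.lt_succ_self m) with h | h | h <;> contradiction
    rcases huv hpb with hpu | hpv
    · exact ⟨m, p, ⟨(p, b), ⟨hpb, hpu⟩, hb, hbv⟩, hnA, hagree, hns,
        agree_insertedPoint_right h3, Or.inl ⟨rfl, rfl⟩⟩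
    · exact ⟨m, p, ⟨(a, p), ⟨ha, hau⟩, hpb, hpv⟩, hnA, hagree, hns,
        agree_insertedPoint_left, Or.inr ⟨rfl, rfl⟩⟩
  choose m p nxt h1 h2 h3 h4 h5 using hstep
  let s : ℕ → Q := fun n => nxt^[n] ⟨(a₀, b₀), ⟨ha₀, hau⟩, hb₀, hbv⟩
  have hs : ∀ n, s (n + 1) = nxt (s n) := fun n => Function.iterate_succ_apply' _ _ _
  have hm : ∀ n, m (s n) < m (s (n + 1)) := by
    intro n
    by_contra! hc
    refine h1 (s (n + 1)) (Agree.mono ?_ (Nat.succ_le_succ hc))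
    rw [hs]
    exact h4 (s n)
  have hmono : StrictMono fun n => m (s n) := strictMono_nat_of_lt_succ hm
  have hnm : ∀ n, n ≤ m (s n) := fun n => hmono.id_le n
  have hp1 : ∀ n i, i < m (s n) → (p (s (n + 1))).seq i = (p (s n)).seq i := by
    intro n i hi
    have e1 := h2 (s (n + 1)) i (hi.trans (hm n))
    have e2 := (h2 (s n) i hi).1
    rcases h5 (s n) with ⟨e, -⟩ | ⟨-, e⟩
    · rw [← hs] at e
      rw [← e] at e2 ⊢
      exact (e1.2.1.resolve_left e2).symm
    · rw [← hs] at e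
      rw [← e] at e2 ⊢
      exact (e1.2.2.resolve_left e2).symm
  have hp2 : ∀ n k i, i < m (s n) → (p (s (n + k))).seq i = (p (s n)).seq i := by
    intro n k i hi
    induction k with
    | zero => rfl
    | succ k ih =>
      rw [← ih]
      exact hp1 (n + k) i (hi.trans_le (hmono.monotone (Nat.le_add_right n k)))
  let z : Itinerary A := fun i => (p (s (i + 1))).seq i
  have hz : ∀ n i, i < m (s n) → (p (s n)).seq i = z i := by
    intro n i hi
    rcases le_total n (i + 1) with h | h
    · obtain ⟨k, hk⟩ := Nat.exists_eq_add_of_le h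
      simp only [z, hk, hp2 n k i hi]
    · obtain ⟨k, hk⟩ := Nat.exists_eq_add_of_le h
      rw [hk, hp2 (i + 1) k i (Nat.lt_of_lt_of_le (Nat.lt_succ_self i) (hnm (i + 1)))]
  have hz0 : ∀ i, z i ≠ none := fun i =>
    (h2 (s (i + 1)) i (Nat.lt_of_lt_of_le (Nat.lt_succ_self i) (hnm (i + 1)))).1
  -- The arcs are nested: a point that does not separate the initial pair separates no later pair.
  have hkeep : ∀ n w, Good ν w → SameSide ν w (s 0).1.1.seq (s 0).1.2.seq →
      SameSide ν w (s n).1.1.seq (s n).1.2.seq := by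
    intro n w hw h0
    induction n with
    | zero => exact h0
    | succ n ih =>
      have e1 : SameSide ν w (s n).1.1.seq (p (s n)).seq := by
        by_contra hc
        exact h3 (s n) (ih.change_center hν hw ((s n).1.1.2.good hν) hc)
      rcases h5 (s n) with ⟨e, e'⟩ | ⟨e, e'⟩
      · rw [hs, e, e']
        exact e1.symm.trans ih
      · rw [hs, e, e']
        exact e1
  -- A common hit at `z` occurs at a finite time, so it would also be a common hit at a bisecting
  -- point that has the same initial symbols.
  have hzs : ¬ SameSide ν z (s 0).1.1.seq (s 0).1.2.seq := by
    rintro ⟨t, e1, e2, -⟩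
    have hc : ∀ i < t + 1, (p (s (t + 1))).seq i = z i := fun i hi =>
      hz _ i (hi.trans_le (hnm _))
    have hc' : ∀ i < t, (p (s (t + 1))).seq i = z i := fun i hi => hc i (by omega)
    refine h3 _ (hkeep (t + 1) _ ((p _).2.good hν) ⟨t, ?_, ?_, fun h => ?_⟩)
    · rwa [Hit, track_congr hc', hc t (Nat.lt_succ_self t)]
    · rwa [Hit, track_congr hc', hc t (Nat.lt_succ_self t)]
    · rw [hc t (Nat.lt_succ_self t)] at h
      exact absurd h (hz0 t)
  obtain ⟨y, hy, hr⟩ := hmem (s 0) z (good_of_ne_none hz0) hzs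
  have hyz : ∀ i, y.seq i = none ∨ y.seq i = z i := by
    intro i
    rcases hr with h | ⟨n, hn, h⟩
    · exact Or.inr (congrFun h i)
    · by_cases hi : i = n
      · rw [hi]
        exact Or.inl hn.2.1
      · exact Or.inr (h i hi).symm
  have hlim : ∀ n, Agree y.seq (s n).1.1.seq (m (s n)) ∧ Agree y.seq (s n).1.2.seq (m (s n)) := by
    intro n
    have aux : ∀ a : Itinerary A, (∀ i < m (s n), a i = none ∨ a i = (p (s n)).seq i) →
        Agree y.seq a (m (s n)) := by
      intro a ha i hi
      rcases hyz i with h | h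
      · exact Or.inl h
      · rcases ha i hi with h' | h'
        · exact Or.inr (Or.inl h')
        · exact Or.inr (Or.inr (by rw [h, h', hz n i hi]))
    exact ⟨aux _ fun i hi => (h2 (s n) i hi).2.1, aux _ fun i hi => (h2 (s n) i hi).2.2⟩
  rcases huv hy with h | h
  · obtain ⟨K, hK⟩ := exists_agree_of_isOpen hν hp hu h
    exact hdisj _ (s K).2.2.1 (hK _ ((hlim K).2.mono (hnm K))) (s K).2.2.2
  · obtain ⟨K, hK⟩ := exists_agree_of_isOpen hν hp hv h
    exact hdisj _ (s K).2.1.1 (s K).2.1.2 (hK _ ((hlim K).1.mono (hnm K)))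

/-- At a branch point there are three points of the Hubbard tree in different branches. -/
theorem exists_three_branches (hν : ∀ i, ν i ≠ none) {N : ℕ}
    (hN : ∀ n, 1 ≤ n → ∃ i < N, ν i ≠ ν (i + n)) (hp : ∀ n, 1 ≤ n → shiftBy n ν ≠ ν)
    {τ : X ν} (hτ : ∀ n, shiftBy n τ.seq ≠ ν) (hτ0 : ∀ i, τ.seq i ≠ none)
    (hb : IsBranchPoint τ) : ∃ x y z : Itinerary A, (x ≠ τ.seq ∧ y ≠ τ.seq ∧ z ≠ τ.seq) ∧
      ¬ SameSide ν τ.seq x y ∧ ¬ SameSide ν τ.seq x z ∧ ¬ SameSide ν τ.seq y z := by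
  have hcard := hb.2
  rw [← Set.encard_univ] at hcard
  obtain ⟨t, -, ht⟩ := Set.exists_subset_encard_eq hcard
  obtain ⟨x, y, z, hxy, hxz, hyz, -⟩ := Set.encard_eq_three.1 ht
  have key : ∀ x y : ↥(hubbardTree ν \ {τ}),
      (x : ConnectedComponents ↥(hubbardTree ν \ {τ})) ≠ y →
      ¬ SameSide ν τ.seq x.1.seq y.1.seq := by
    intro x y hne hs
    refine hne (ConnectedComponents.coe_eq_coe'.2 ?_)
    have hsub : branch τ y.1 ⊆ hubbardTree ν \ {τ} := by
      rintro w ⟨hw, hw'⟩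
      refine ⟨hw, ?_⟩
      rintro rfl
      exact not_sameSide_right _ _ hw'
    have hpre : IsPreconnected ((↑) ⁻¹' branch τ y.1 : Set ↥(hubbardTree ν \ {τ})) := by
      rw [← Topology.IsInducing.subtypeVal.isPreconnected_image, Subtype.image_preimage_coe,
        Set.inter_eq_right.2 hsub]
      exact isPreconnected_branch hν hN hp hτ hτ0 y.1
    refine hpre.subset_connectedComponent ?_ ?_
    · refine ⟨y.2.1, SameSide.refl fun h => y.2.2 (Subtype.ext h)⟩
    · exact ⟨x.2.1, hs.symm⟩
  obtain ⟨x, rfl⟩ := ConnectedComponents.surjective_coe x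
  obtain ⟨y, rfl⟩ := ConnectedComponents.surjective_coe y
  obtain ⟨z, rfl⟩ := ConnectedComponents.surjective_coe z
  have hne : ∀ x : ↥(hubbardTree ν \ {τ}), x.1.seq ≠ τ.seq := fun x h =>
    x.2.2 (Subtype.ext h)
  exact ⟨_, _, _, ⟨hne x, hne y, hne z⟩, key x y hxy, key x z hxz, key y z hyz⟩

/-! ### Finiteness -/

theorem exists_last_before {P : ℕ → Prop} {s t : ℕ} (hs : P s) (hst : s < t) :
    ∃ u, s ≤ u ∧ u < t ∧ P u ∧ ∀ i, u < i → i < t → ¬ P i := by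
  induction t with
  | zero => omega
  | succ t ih =>
    by_cases ht : P t
    · exact ⟨t, by omega, by omega, ht, fun i _ _ => by omega⟩
    · have hst' : s < t := by
        rcases Nat.lt_succ_iff_lt_or_eq.1 hst with h | rfl
        · exact h
        · exact absurd hs ht
      obtain ⟨u, h1, h2, h3, h4⟩ := ih hst'
      refine ⟨u, h1, by omega, h3, fun i hi hit => ?_⟩
      rcases Nat.lt_succ_iff_lt_or_eq.1 hit with h | rfl
      · exact h4 i hi h
      · exact ht

open Classical in
theorem exists_first_after {P : ℕ → Prop} (h : ∀ m, ∃ n, m ≤ n ∧ P n) (s : ℕ) :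
    ∃ t, s < t ∧ P t ∧ ∀ i, s < i → i < t → ¬ P i := by
  have hex : ∃ t, s < t ∧ P t := h (s + 1)
  exact ⟨Nat.find hex, (Nat.find_spec hex).1, (Nat.find_spec hex).2, fun i h1 h2 h3 =>
    Nat.find_min hex h2 ⟨h1, h3⟩⟩

theorem exists_hit_after {τ x : Itinerary A} (hτ : ∀ n, shiftBy n τ ≠ ν) (hx : x ≠ τ) (m : ℕ) :
    ∃ n, m ≤ n ∧ Hit ν τ x n := by
  induction m with
  | zero => exact exists_hit 0 hx
  | succ m ih =>
    obtain ⟨n, hmn, hn⟩ := ih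
    obtain ⟨k, hk, hk'⟩ := exists_hit (ν := ν) (z := τ) (x := x) (n + 1)
      (by rw [track_succ_of_hit hn]; exact (hτ _).symm)
    exact ⟨k, by omega, hk'⟩

/-- `τ` lies between each two of the points `σᵏν`, `σˡν` and `ν`. -/
def IsMiddle (ν : Itinerary A) (k l : ℕ) (τ : Itinerary A) : Prop :=
  ¬ SameSide ν τ (shiftBy k ν) (shiftBy l ν) ∧ ¬ SameSide ν τ (shiftBy k ν) ν ∧
    ¬ SameSide ν τ (shiftBy l ν) ν

/-- From the hit at `s` until just before `t`, `y` follows `τ` as ν and `z` as a proper iterate of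
ν. The resulting self-agreement of ν has length `t - s - 1`, which must be less than `N`. -/
theorem isMiddle_of_hits {N : ℕ} (hN : ∀ n, 1 ≤ n → ∃ i < N, ν i ≠ ν (i + n))
    {τ x y z : Itinerary A}
    (h : ¬ SameSide ν τ x y ∧ ¬ SameSide ν τ x z ∧ ¬ SameSide ν τ y z) {r s u t : ℕ}
    (hrs : r < s) (hsu : s < u) (hut : u < t)
    (hr : Hit ν τ z r) (hrt : ∀ i, r < i → i < t → ¬ Hit ν τ z i) (ht : Hit ν τ z t)
    (hs : Hit ν τ y s) (hst : ∀ i, s < i → i ≤ t → ¬ Hit ν τ y i)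
    (hu : Hit ν τ x u) (hut' : ∀ i, u < i → i ≤ t → ¬ Hit ν τ x i) :
    ∃ k ≤ N, ∃ l ≤ N, ∃ T, IsMiddle ν k l (shiftBy T τ) := by
  have e1 : track ν τ x (t + 1) = shiftBy (t - u) ν := by
    have := track_of_not_hit (ν := ν) (z := τ) (x := x) (m := u + 1) (n := t - u)
      fun i hi => hut' _ (by omega) (by omega)
    rwa [track_succ_of_hit hu, show u + 1 + (t - u) = t + 1 by omega] at this
  have e2 : track ν τ y (t + 1) = shiftBy (t - s) ν := by
    have := track_of_not_hit (ν := ν) (z := τ) (x := y) (m := s + 1) (n := t - s)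
      fun i hi => hst _ (by omega) (by omega)
    rwa [track_succ_of_hit hs, show s + 1 + (t - s) = t + 1 by omega] at this
  have e3 : track ν τ z (t + 1) = ν := track_succ_of_hit ht
  have hbound : t - s ≤ N := by
    obtain ⟨j, hj, hne⟩ := hN (s - r) (by omega)
    by_contra hlt
    have f1 := eq_of_not_hit (ν := ν) (z := τ) (x := y) (m := s + 1) (n := j)
      fun i hi => hst _ (by omega) (by omega)
    have f2 := eq_of_not_hit (ν := ν) (z := τ) (x := z) (m := r + 1) (n := j + (s - r))
      fun i hi => hrt _ (by omega) (by omega)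
    rw [track_succ_of_hit hs] at f1
    rw [track_succ_of_hit hr, show r + 1 + (j + (s - r)) = s + 1 + j by omega] at f2
    exact hne (f1.trans f2.symm)
  refine ⟨t - u, by omega, t - s, hbound, t + 1, ?_, ?_, ?_⟩
  · rw [← e1, ← e2]
    exact fun h' => h.1 h'.of_shiftBy
  · intro h'
    rw [← e1] at h'
    refine h.2.1 (SameSide.of_shiftBy (n := t + 1) ?_)
    rwa [e3]
  · intro h'
    rw [← e2] at h'
    refine h.2.2 (SameSide.of_shiftBy (n := t + 1) ?_)
    rwa [e3]

theorem exists_isMiddle_aux {N : ℕ} (hN : ∀ n, 1 ≤ n → ∃ i < N, ν i ≠ ν (i + n))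
    {τ x y z : Itinerary A} (hτ0 : ∀ i, τ i ≠ none)
    (h : ¬ SameSide ν τ x y ∧ ¬ SameSide ν τ x z ∧ ¬ SameSide ν τ y z) {q s v t : ℕ}
    (hqs : q < s) (hsv : s < v) (hvt : v < t) (hq : Hit ν τ z q) (hs : Hit ν τ x s)
    (hv : Hit ν τ y v) (ht : Hit ν τ z t) (hst : ∀ i, s < i → i < t → ¬ Hit ν τ z i) :
    ∃ k ≤ N, ∃ l ≤ N, ∃ T, IsMiddle ν k l (shiftBy T τ) := by
  have hdis : ∀ {a b : Itinerary A} {n : ℕ}, ¬ SameSide ν τ a b → Hit ν τ a n →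
      ¬ Hit ν τ b n := fun h h1 h2 => h ⟨_, h1, h2, fun h => absurd h (hτ0 _)⟩
  obtain ⟨r, -, hrs, hr, hr'⟩ := exists_last_before hq hqs
  obtain ⟨a, hsa, hat, ha, ha'⟩ := exists_last_before hs (hsv.trans hvt)
  obtain ⟨b, hvb, hbt, hb, hb'⟩ := exists_last_before hv hvt
  have hzr : ∀ i, r < i → i < t → ¬ Hit ν τ z i := by
    intro i hri hit
    rcases lt_trichotomy i s with h' | rfl | h'
    · exact hr' i hri h'
    · exact hdis h.2.1 hs
    · exact hst i h' hit
  have hat' : ∀ i, a < i → i ≤ t → ¬ Hit ν τ x i := by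
    intro i hi hit
    rcases hit.lt_or_eq with h' | rfl
    · exact ha' i hi h'
    · exact fun h' => hdis h.2.1 h' ht
  have hbt' : ∀ i, b < i → i ≤ t → ¬ Hit ν τ y i := by
    intro i hi hit
    rcases hit.lt_or_eq with h' | rfl
    · exact hb' i hi h'
    · exact fun h' => hdis h.2.2 h' ht
  -- The later of the last hits of `x` and `y` plays the role of `u`, the earlier that of `s`.
  rcases lt_trichotomy a b with hab | rfl | hab
  · exact isMiddle_of_hits hN ⟨fun h' => h.1 h'.symm, h.2.2, h.2.1⟩ (by omega) hab hbt hr hzr ht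
      ha hat' hb hbt'
  · exact absurd hb (hdis h.1 ha)
  · exact isMiddle_of_hits hN h (by omega) hab hat hr hzr ht hb hbt' ha hat'

theorem exists_isMiddle {N : ℕ} (hN : ∀ n, 1 ≤ n → ∃ i < N, ν i ≠ ν (i + n))
    {τ x y z : Itinerary A} (hτ : ∀ n, shiftBy n τ ≠ ν) (hτ0 : ∀ i, τ i ≠ none)
    (hne : x ≠ τ ∧ y ≠ τ ∧ z ≠ τ)
    (h : ¬ SameSide ν τ x y ∧ ¬ SameSide ν τ x z ∧ ¬ SameSide ν τ y z) :
    ∃ k ≤ N, ∃ l ≤ N, ∃ T, IsMiddle ν k l (shiftBy T τ) := by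
  have hx := exists_hit_after hτ hne.1
  have hy := exists_hit_after hτ hne.2.1
  have hz := exists_hit_after hτ hne.2.2
  obtain ⟨q, -, hq⟩ := hy 0
  obtain ⟨q', -, hq'⟩ := hz 0
  -- Both `y` and `z` have been hit before `s`, so whichever is hit second after `s` can serve as
  -- the reference point.
  obtain ⟨s, hqs, hs⟩ := hx (q + q' + 1)
  obtain ⟨t, hst, ht, htm⟩ := exists_first_after hy s
  obtain ⟨t', hst', ht', htm'⟩ := exists_first_after hz s
  rcases lt_trichotomy t t' with htt | rfl | htt
  · exact exists_isMiddle_aux hN hτ0 h (by omega) hst htt hq' hs ht ht' htm'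
  · exact absurd ⟨t, ht, ht', fun h => absurd h (hτ0 t)⟩ h.2.2
  · exact exists_isMiddle_aux hN hτ0 ⟨h.2.1, h.1, fun h' => h.2.2 h'.symm⟩ (by omega) hst' htt
      hq hs ht' ht htm

theorem finite_range_iterate {α : Type*} {f : α → α} {x : α} (hx : x ∈ Function.periodicPts f) :
    (Set.range fun n => f^[n] x).Finite := by
  obtain ⟨p, hp, hper⟩ := hx
  refine ((Set.finite_Iio p).image fun n => f^[n] x).subset ?_
  rintro _ ⟨n, rfl⟩
  exact ⟨n % p, Nat.mod_lt _ hp, hper.iterate_mod_apply n⟩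

theorem mem_range_iterate {α : Type*} {f : α → α} {x : α} (hx : x ∈ Function.periodicPts f)
    (T : ℕ) : x ∈ Set.range fun n => f^[n] (f^[T] x) := by
  obtain ⟨p, hp, hper⟩ := hx
  refine ⟨p * T - T, ?_⟩
  change f^[p * T - T] (f^[T] x) = x
  rw [← Function.iterate_add_apply, Nat.sub_add_cancel (Nat.le_mul_of_pos_left T hp)]
  exact hper.mul_const T

theorem shiftBy_ne_of_periodic (hp : ∀ n, 1 ≤ n → shiftBy n ν ≠ ν) {τ : X ν}
    (hτ : τ ∈ Function.periodicPts (X.shift (ν := ν))) (n : ℕ) : shiftBy n τ.seq ≠ ν := by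
  obtain ⟨p, hp0, hper⟩ := hτ
  intro h
  have h1 : shiftBy p τ.seq = τ.seq := by
    rw [← seq_shift_iterate]
    exact congrArg X.seq hper
  refine hp p hp0 ?_
  rw [← h, shiftBy_shiftBy, Nat.add_comm, ← shiftBy_shiftBy, h1]

theorem finite_of_isMiddle (hν : ∀ i, ν i ≠ none) (hp : ∀ n, 1 ≤ n → shiftBy n ν ≠ ν)
    (k l : ℕ) : {τ : X ν | τ ∈ Function.periodicPts (X.shift (ν := ν)) ∧
      ∃ T, IsMiddle ν k l (shiftBy T τ.seq)}.Finite := by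
  rcases Set.eq_empty_or_nonempty {τ : X ν | τ ∈ Function.periodicPts (X.shift (ν := ν)) ∧
      ∃ T, IsMiddle ν k l (shiftBy T τ.seq)} with he | ⟨τ₀, hτ₀, T₀, hT₀⟩
  · rw [he]
    exact Set.finite_empty
  have h0 : ∀ {τ : X ν}, τ ∈ Function.periodicPts (X.shift (ν := ν)) → ∀ i, τ.seq i ≠ none :=
    fun {τ} hτ i hi => shiftBy_ne_of_periodic hp hτ _ (τ.2.good hν i hi)
  have hper : X.shift^[T₀] τ₀ ∈ Function.periodicPts (X.shift (ν := ν)) := by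
    obtain ⟨p, hp0, hper⟩ := hτ₀
    exact ⟨p, hp0, hper.apply_iterate T₀⟩
  -- By uniqueness of the middle, every such `τ` has an iterate in common with `τ₀`, and periodicity
  -- puts `τ` itself on that orbit.
  refine (finite_range_iterate hper).subset ?_
  rintro τ ⟨hτ, T, hT⟩
  have heq : X.shift^[T₀] τ₀ = X.shift^[T] τ := by
    refine Subtype.ext ?_
    change X.seq _ = X.seq _
    rw [seq_shift_iterate, seq_shift_iterate]
    exact eq_of_three_branches (fun i => h0 hτ₀ _) (fun i => h0 hτ _) hT₀ hT
  rw [heq]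
  exact mem_range_iterate hτ T

theorem exists_bound_of_not_isRecurrent (h : ¬ IsRecurrent ν) :
    ∃ N, ∀ n, 1 ≤ n → ∃ i < N, ν i ≠ ν (i + n) := by
  unfold IsRecurrent at h
  push Not at h
  obtain ⟨k, hk⟩ := h
  refine ⟨k - 1, fun n hn => ?_⟩
  by_contra! hc
  exact absurd (hk n hn) (not_lt.2 (le_diff_iff.2 fun i hi => Or.inr (Or.inr (hc i hi))))

end Kneading

theorem mainTheorem11 {A : Type*} [Countable A] [Nontrivial A] (ν : Kneading.Itinerary A)
    (hν : Kneading.IsKneadingSequence ν) (hrec : ¬ Kneading.IsRecurrent ν) :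
    {τ : Kneading.X ν | Kneading.IsBranchPoint τ ∧
      τ ∈ Function.periodicPts (Kneading.X.shift (ν := ν))}.Finite := by
  obtain ⟨h0, h1⟩ := Kneading.not_isRecurrent_imp hν hrec
  have hp : ∀ n, 1 ≤ n → Kneading.shiftBy n ν ≠ ν := fun n hn h => h1 n hn (congrFun h)
  obtain ⟨N, hN⟩ := Kneading.exists_bound_of_not_isRecurrent hrec
  refine (((Set.finite_Iic N).prod (Set.finite_Iic N)).biUnion
    fun q _ => Kneading.finite_of_isMiddle h0 hp q.1 q.2).subset ?_
  rintro τ ⟨hb, hper⟩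
  have hτ := Kneading.shiftBy_ne_of_periodic hp hper
  have hτ0 : ∀ i, τ.seq i ≠ none := fun i hi => hτ _ (τ.2.good h0 i hi)
  obtain ⟨x, y, z, hne, hxyz⟩ := Kneading.exists_three_branches h0 hN hp hτ hτ0 hb
  obtain ⟨k, hk, l, hl, T, hT⟩ := Kneading.exists_isMiddle hN hτ hτ0 hne hxyz
  exact Set.mem_biUnion (x := (k, l)) ⟨hk, hl⟩ ⟨hper, T, hT⟩
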